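/- For a finite nonempty simple graph $G$ on $n$ vertices let $G^k$ be the $k$-fold categorical product $G\times\cdots\times G$ (vertices are the $k$-tuples of vertices of $G$; two tuples are adjacent iff they are adjacent in every coordinate), let $\alpha$ denote the independence number, and let the tensor capacity of $G$ be $$\Theta^T(G)=\lim_{k\to\infty}\frac{\alpha(G^k)}{n^k}.$$ A cograph is a graph with no induced path on four vertices. Theorem. There is a polynomial-time algorithm which computes the tensor capacity of cographs. That is, there are a single random access machine program (memory of natural-number registers and indirectly addressed arrays; addition, truncated subtraction, comparisons and memory accesses at unit cost, no unit-cost multiplication) and a polynomial $P$ such that, for every $n\ge 1$ and every cograph $G$ with vertex set $\{0,\dots,n-1\}$, given as $n$ and its adjacency matrix, the program halts after at most $P(n)$ steps and outputs natural numbers $p$ and $q\neq 0$ such that the limit defining $\Theta^T(G)$ exists and equals $p/q$. -/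

import Mathlib

namespace TensorCap

open Filter Topology

/-! ### Graphs -/

/-- The categorical (tensor, direct) product `G × H`: `(g₁, h₁)` and `(g₂, h₂)` are adjacent
iff `g₁ g₂` is an edge of `G` and `h₁ h₂` is an edge of `H`. -/
def tensorProd {V W : Type*} (G : SimpleGraph V) (H : SimpleGraph W) :
    SimpleGraph (V × W) where
  Adj x y := G.Adj x.1 y.1 ∧ H.Adj x.2 y.2
  symm := ⟨fun _ _ h => ⟨h.1.symm, h.2.symm⟩⟩
  loopless := ⟨fun _ h => G.irrefl h.1⟩

/-- The `k`-fold categorical product `G^k = G × ⋯ × G`: two `k`-tuples are adjacent iff they are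
adjacent in every coordinate. The clause `f ≠ g` only matters for `k = 0`
(see `tensorPow_adj`), where it excludes a loop. -/
def tensorPow {V : Type*} (G : SimpleGraph V) (k : ℕ) : SimpleGraph (Fin k → V) where
  Adj f g := f ≠ g ∧ ∀ i, G.Adj (f i) (g i)
  symm := ⟨fun _ _ h => ⟨h.1.symm, fun i => (h.2 i).symm⟩⟩
  loopless := ⟨fun _ h => h.1 rfl⟩

theorem tensorPow_adj {V : Type*} (G : SimpleGraph V) {k : ℕ} (hk : 0 < k) (f g : Fin k → V) :
    (tensorPow G k).Adj f g ↔ ∀ i, G.Adj (f i) (g i) := by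
  refine ⟨fun h => h.2, fun h => ⟨?_, h⟩⟩
  rintro rfl
  exact G.irrefl (h ⟨0, hk⟩)

/-- `G^1 ≅ G`. -/
def tensorPowOne {V : Type*} (G : SimpleGraph V) : tensorPow G 1 ≃g G where
  toEquiv := Equiv.funUnique (Fin 1) V
  map_rel_iff' {f g} := by
    rw [tensorPow_adj G Nat.one_pos]
    simp [Fin.forall_fin_one]

/-- `G^(k+1) ≅ G × G^k` for `k ≥ 1`. -/
def tensorPowSucc {V : Type*} (G : SimpleGraph V) {k : ℕ} (hk : 0 < k) :
    tensorPow G (k + 1) ≃g tensorProd G (tensorPow G k) where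
  toEquiv := (Fin.consEquiv (fun _ : Fin (k + 1) => V)).symm
  map_rel_iff' {f g} := by
    rw [tensorPow_adj G k.succ_pos]
    simp only [tensorProd, tensorPow_adj G hk, Fin.forall_fin_succ]
    rfl

/-- The independence ratio `r(G) = α(G) / |V(G)|` of a finite nonempty graph. -/
noncomputable def indepRatio {V : Type*} (G : SimpleGraph V) : ℝ :=
  (G.indepNum : ℝ) / (Nat.card V : ℝ)

/-- `θ` is the tensor capacity `Θ^T(G) = lim_{k → ∞} r(G^k)` of `G`
(the limit exists and equals `θ`). -/
def IsTensorCapacity {V : Type*} (G : SimpleGraph V) (θ : ℝ) : Prop :=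
  Tendsto (fun k : ℕ => indepRatio (tensorPow G k)) atTop (𝓝 θ)

/-- A cograph is a graph without an induced path on four vertices. -/
def IsCograph {V : Type*} (G : SimpleGraph V) : Prop :=
  IsEmpty (SimpleGraph.pathGraph 4 ↪g G)

/-! ### Random access machines

A random access machine whose memory consists of scalar registers and one-dimensional arrays of
natural numbers; a program mentions only finitely many of them. All arithmetic is addition,
truncated subtraction and comparison at unit cost (there is no unit-cost multiplication, so the
bit length of the numbers grows by at most a constant per step), and array cells are addressed
indirectly. -/

/-- Memory contents: `var x` is register `x` and `arr a i` is cell `i` of array `a`. -/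
@[ext]
structure State where
  var : ℕ → ℕ
  arr : ℕ → ℕ → ℕ

/-- Expressions. -/
inductive Exp : Type where
  | const (c : ℕ)
  | var (x : ℕ)
  | get (a : ℕ) (i : Exp)
  | add (e₁ e₂ : Exp)
  | sub (e₁ e₂ : Exp)
  | lt (e₁ e₂ : Exp)
  | eq (e₁ e₂ : Exp)

/-- The value of an expression; comparisons return `1` for true and `0` for false. -/
def Exp.eval (s : State) : Exp → ℕ
  | .const c => c
  | .var x => s.var x
  | .get a i => s.arr a (i.eval s)
  | .add e₁ e₂ => e₁.eval s + e₂.eval s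
  | .sub e₁ e₂ => e₁.eval s - e₂.eval s
  | .lt e₁ e₂ => if e₁.eval s < e₂.eval s then 1 else 0
  | .eq e₁ e₂ => if e₁.eval s = e₂.eval s then 1 else 0

/-- The number of elementary operations needed to evaluate an expression. -/
def Exp.cost : Exp → ℕ
  | .const _ => 1
  | .var _ => 1
  | .get _ i => i.cost + 1
  | .add e₁ e₂ => e₁.cost + e₂.cost + 1
  | .sub e₁ e₂ => e₁.cost + e₂.cost + 1
  | .lt e₁ e₂ => e₁.cost + e₂.cost + 1
  | .eq e₁ e₂ => e₁.cost + e₂.cost + 1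

/-- Programs: `assign x e` is `x := e`, `put a i e` is `a[i] := e`, `ite e c₁ c₂` runs `c₁` if `e`
is nonzero and `c₂` otherwise, and `loop e c` is `while e ≠ 0 do c`. -/
inductive Prog : Type where
  | skip
  | assign (x : ℕ) (e : Exp)
  | put (a : ℕ) (i e : Exp)
  | seq (c₁ c₂ : Prog)
  | ite (e : Exp) (c₁ c₂ : Prog)
  | loop (e : Exp) (c : Prog)

/-- The memory after `x := v`. -/
def State.setVar (s : State) (x v : ℕ) : State :=
  { s with var := Function.update s.var x v }

/-- The memory after `a[i] := v`. -/
def State.setArr (s : State) (a i v : ℕ) : State :=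
  { s with arr := Function.update s.arr a (Function.update (s.arr a) i v) }

/-- `Exec c s t s'`: started on memory `s`, the program `c` halts with memory `s'` after exactly
`t` elementary steps. -/
inductive Exec : Prog → State → ℕ → State → Prop where
  | skip (s : State) : Exec .skip s 1 s
  | assign (s : State) (x : ℕ) (e : Exp) :
      Exec (.assign x e) s (e.cost + 1) (s.setVar x (e.eval s))
  | put (s : State) (a : ℕ) (i e : Exp) :
      Exec (.put a i e) s (i.cost + e.cost + 1) (s.setArr a (i.eval s) (e.eval s))
  | seq {c₁ c₂ : Prog} {s s' s'' : State} {t₁ t₂ : ℕ} :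
      Exec c₁ s t₁ s' → Exec c₂ s' t₂ s'' → Exec (.seq c₁ c₂) s (t₁ + t₂) s''
  | iteTrue {e : Exp} {c₁ c₂ : Prog} {s s' : State} {t : ℕ} :
      e.eval s ≠ 0 → Exec c₁ s t s' → Exec (.ite e c₁ c₂) s (e.cost + 1 + t) s'
  | iteFalse {e : Exp} {c₁ c₂ : Prog} {s s' : State} {t : ℕ} :
      e.eval s = 0 → Exec c₂ s t s' → Exec (.ite e c₁ c₂) s (e.cost + 1 + t) s'
  | loopDone {e : Exp} {c : Prog} {s : State} :
      e.eval s = 0 → Exec (.loop e c) s (e.cost + 1) s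
  | loopStep {e : Exp} {c : Prog} {s s' s'' : State} {t₁ t₂ : ℕ} :
      e.eval s ≠ 0 → Exec c s t₁ s' → Exec (.loop e c) s' t₂ s'' →
      Exec (.loop e c) s (e.cost + 1 + t₁ + t₂) s''

/-- Programs are deterministic: the final memory and the number of steps are unique. -/
theorem Exec.deterministic {c : Prog} {s s₁ s₂ : State} {t₁ t₂ : ℕ}
    (h₁ : Exec c s t₁ s₁) (h₂ : Exec c s t₂ s₂) : t₁ = t₂ ∧ s₁ = s₂ := by
  induction h₁ generalizing t₂ s₂ with
  | skip s => cases h₂; exact ⟨rfl, rfl⟩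
  | assign s x e => cases h₂; exact ⟨rfl, rfl⟩
  | put s a i e => cases h₂; exact ⟨rfl, rfl⟩
  | seq _ _ ih₁ ih₂ =>
    cases h₂ with
    | seq k₁ k₂ =>
      obtain ⟨rfl, rfl⟩ := ih₁ k₁
      obtain ⟨rfl, rfl⟩ := ih₂ k₂
      exact ⟨rfl, rfl⟩
  | iteTrue h _ ih =>
    cases h₂ with
    | iteTrue _ k => obtain ⟨rfl, rfl⟩ := ih k; exact ⟨rfl, rfl⟩
    | iteFalse h' _ => exact absurd h' h
  | iteFalse h _ ih =>
    cases h₂ with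
    | iteTrue h' _ => exact absurd h h'
    | iteFalse _ k => obtain ⟨rfl, rfl⟩ := ih k; exact ⟨rfl, rfl⟩
  | loopDone h =>
    cases h₂ with
    | loopDone _ => exact ⟨rfl, rfl⟩
    | loopStep h' _ _ => exact absurd h h'
  | loopStep h _ _ ih₁ ih₂ =>
    cases h₂ with
    | loopDone h' => exact absurd h' h
    | loopStep _ k₁ k₂ =>
      obtain ⟨rfl, rfl⟩ := ih₁ k₁
      obtain ⟨rfl, rfl⟩ := ih₂ k₂
      exact ⟨rfl, rfl⟩

open Classical in
/-- The input memory for a graph `G` with vertices `0, …, n - 1`: register `0` holds `n`, array `0`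
holds the adjacency matrix of `G` row by row, and everything else is `0`. -/
noncomputable def inputState {n : ℕ} (G : SimpleGraph (Fin n)) : State where
  var x := if x = 0 then n else 0
  arr a p := if a = 0 ∧ ∃ i j : Fin n, p = (i : ℕ) * n + (j : ℕ) ∧ G.Adj i j then 1 else 0

end TensorCap

/-! The capacity is governed by the ratio |N(U)|/|U| over nonempty independent sets U. If some U has
|N(U)| < |U|, the capacity is 1: there are positive vertex weights with product at least 1 along
every edge and average below 1, and the tuples whose weights multiply to less than 1 form an
independent set with complement of exponentially small density (`isTensorCapacity_one`).

Otherwise let p/q ≥ 1 be the minimum ratio. The inequality p|U| ≤ q|N(U)| for all independent U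
passes to tensor products, thanks to q ≤ p (`Expands.tensorProd`), and bounds every independence
ratio by q/(p+q). Conversely, iterating the construction of `indepNum_tensorPow_succ_ge` with a
minimiser U reaches this bound in the limit.

It remains to find the minimum ratio, and a minimiser shows that p, q ≤ n suffices. The maximum of
P|U| - Q|N(U)| obeys simple rules for disjoint unions and for joins (`IsValue.union_of_not_adj`,
`IsValue.union_of_adj`). Any two or more vertices of a cograph contain twins
(`P4Free.exists_twins`), so merging twin modules computes the maximum for the whole graph. For P = 1
+ pN and Q = qN with N = n + 1 it lies strictly between 0 and N exactly when p/q is the minimum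
ratio (`IsValue.isMinRatio_iff`). The program tests all pairs 1 ≤ q ≤ p ≤ n, with 1/1 as default
answer; products are maintained by repeated addition. -/

namespace TensorCap

open Filter Topology Finset

/-! ### Neighbourhood expansion and the tensor capacity -/

section Capacity
open Classical

variable {V W : Type*} [Fintype V] [Fintype W]

/-- No two vertices of `U` are adjacent. -/
def Indep {V : Type*} (G : SimpleGraph V) (U : Finset V) : Prop :=
  ∀ x ∈ U, ∀ y ∈ U, ¬G.Adj x y

/-- The vertices that have a neighbour in `U`. -/
noncomputable def nbhd (G : SimpleGraph V) (U : Finset V) : Finset V :=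
  {v | ∃ u ∈ U, G.Adj u v}

theorem mem_nbhd {G : SimpleGraph V} {U : Finset V} {v : V} :
    v ∈ nbhd G U ↔ ∃ u ∈ U, G.Adj u v := by
  simp [nbhd]

theorem nbhd_mono (G : SimpleGraph V) {S T : Finset V} (h : S ⊆ T) : nbhd G S ⊆ nbhd G T := by
  intro v hv
  obtain ⟨u, hu, huv⟩ := mem_nbhd.1 hv
  exact mem_nbhd.2 ⟨u, h hu, huv⟩

theorem indep_iff_isIndepSet {V : Type*} {G : SimpleGraph V} {U : Finset V} :
    Indep G U ↔ G.IsIndepSet (U : Set V) := by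
  constructor
  · intro h x hx y hy _
    exact h x hx y hy
  · intro h x hx y hy hxy
    exact h hx hy hxy.ne hxy

theorem Indep.card_le {V : Type*} [Finite V] {G : SimpleGraph V} {U : Finset V}
    (h : Indep G U) : #U ≤ G.indepNum :=
  (indep_iff_isIndepSet.1 h).card_le_indepNum

theorem exists_indep_card {V : Type*} [Finite V] (G : SimpleGraph V) : ∃ U, Indep G U ∧ #U = G.indepNum := by
  obtain ⟨U, hU⟩ := G.exists_isNIndepSet_indepNum
  exact ⟨U, indep_iff_isIndepSet.2 hU.1, hU.2⟩

theorem Indep.card_add_card_nbhd_le {G : SimpleGraph V} {U : Finset V} (h : Indep G U) :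
    #U + #(nbhd G U) ≤ Fintype.card V := by
  rw [← card_union_of_disjoint]
  · exact card_le_univ _
  · rw [Finset.disjoint_left]
    intro v hv hv'
    obtain ⟨u, hu, huv⟩ := mem_nbhd.1 hv'
    exact h u hu v hv huv

/-- Every independent set `U` satisfies `|N(U)| ≥ (p / q) |U|`. -/
def Expands (p q : ℕ) (G : SimpleGraph V) : Prop :=
  ∀ U : Finset V, Indep G U → p * #U ≤ q * #(nbhd G U)

/-- Split T into the vertices T₁ without a neighbour in T and the rest T₂. The set S ∪ T₁ is
independent, so it expands; T₂ lies in N(T) and misses N(S ∪ T₁). Since q ≤ p, the part T₁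
contributes at least its own size. The set T itself need not be independent. -/
theorem Expands.card_union {p q : ℕ} (hqp : q ≤ p) {G : SimpleGraph V} (hG : Expands p q G)
    {S T : Finset V} (hS : Indep G S) (hST : ∀ x ∈ S, ∀ y ∈ T, ¬G.Adj x y)
    (hd : Disjoint S T) : p * #S + q * #T ≤ q * #(nbhd G (S ∪ T)) := by
  set T₁ := T.filter fun y => ∀ x ∈ T, ¬G.Adj x y with hT₁
  set T₂ := T.filter fun y => ¬∀ x ∈ T, ¬G.Adj x y with hT₂
  have hT : #T₁ + #T₂ = #T := card_filter_add_card_filter_not _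
  have hT₁T : T₁ ⊆ T := filter_subset _ _
  have hI : Indep G (S ∪ T₁) := by
    intro x hx y hy hxy
    rcases mem_union.1 hx with hx | hx <;> rcases mem_union.1 hy with hy | hy
    · exact hS x hx y hy hxy
    · exact hST x hx y (hT₁T hy) hxy
    · exact hST y hy x (hT₁T hx) hxy.symm
    · exact (mem_filter.1 hy).2 x (hT₁T hx) hxy
  have h₁ := hG _ hI
  rw [card_union_of_disjoint (hd.mono_right hT₁T)] at h₁
  have hdis : Disjoint (nbhd G (S ∪ T₁)) T₂ := by
    rw [Finset.disjoint_left]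
    intro v hv hv₂
    obtain ⟨u, hu, huv⟩ := mem_nbhd.1 hv
    have hvT := (mem_filter.1 hv₂).1
    rcases mem_union.1 hu with hu | hu
    · exact hST u hu v hvT huv
    · exact (mem_filter.1 hu).2 v hvT huv.symm
  have hsub : nbhd G (S ∪ T₁) ∪ T₂ ⊆ nbhd G (S ∪ T) := by
    apply union_subset (nbhd_mono G (union_subset_union_right hT₁T))
    intro v hv
    have := (mem_filter.1 hv).2
    push Not at this
    obtain ⟨x, hx, hxv⟩ := this
    exact mem_nbhd.2 ⟨x, mem_union_right _ hx, hxv⟩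
  have h₂ := card_le_card hsub
  rw [card_union_of_disjoint hdis] at h₂
  have h₃ := Nat.mul_le_mul_left q h₂
  have h₄ := Nat.mul_le_mul_right #T₁ hqp
  rw [← hT]
  linarith

theorem card_eq_sum_fst (X : Finset (V × W)) :
    #X = ∑ x, #{y : W | (x, y) ∈ X} := by
  simp only [card_filter]
  rw [← Fintype.sum_prod_type (fun z : V × W => if z ∈ X then 1 else 0)]
  simp

theorem card_eq_sum_snd (X : Finset (V × W)) :
    #X = ∑ y, #{x : V | (x, y) ∈ X} := by
  simp only [card_filter]
  rw [← Fintype.sum_prod_type_right (fun z : V × W => if z ∈ X then 1 else 0)]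
  simp

/-- Let A consist of the points of U with no G-neighbour in their own horizontal fibre of U, and B
of the others. Each fibre of A is independent in G, so the fibrewise neighbourhood M satisfies p|A|
≤ q|M|. In the vertical fibre over z, B is independent, disjoint from M and without edges to M, so
`Expands.card_union` applies in H. Each point of B or M over z has a point of U horizontally next to
it, so the H-neighbours found lie in N(U). -/
theorem Expands.tensorProd {p q : ℕ} (hqp : q ≤ p) {G : SimpleGraph V} {H : SimpleGraph W}
    (hG : Expands p q G) (hH : Expands p q H) : Expands p q (tensorProd G H) := by
  intro U hU
  set A := U.filter fun z => ∀ x, (x, z.2) ∈ U → ¬G.Adj x z.1 with hA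
  set B := U.filter fun z => ¬∀ x, (x, z.2) ∈ U → ¬G.Adj x z.1 with hB
  have hAB : #A + #B = #U := card_filter_add_card_filter_not _
  set M : Finset (V × W) := {z | ∃ x, (x, z.2) ∈ A ∧ G.Adj x z.1} with hM
  have h₁ : p * #A ≤ q * #M := by
    rw [card_eq_sum_snd A, card_eq_sum_snd M, mul_sum, mul_sum]
    refine sum_le_sum fun y _ => ?_
    have := hG {x : V | (x, y) ∈ A} (by
      intro x hx x' hx' h
      simp only [hA, mem_filter, mem_univ, true_and] at hx hx'
      exact hx'.2 x hx.1 h)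
    have hMy : ({x | (x, y) ∈ M} : Finset V) = nbhd G {x | (x, y) ∈ A} := by
      ext z
      rw [mem_nbhd]
      simp [hM]
    rwa [hMy]
  have h₂ : p * #B + q * #M ≤ q * #(nbhd (TensorCap.tensorProd G H) U) := by
    rw [card_eq_sum_fst B, card_eq_sum_fst M, card_eq_sum_fst (nbhd _ U), mul_sum, mul_sum,
      mul_sum, ← sum_add_distrib]
    refine sum_le_sum fun z _ => ?_
    refine (hH.card_union hqp (S := ({y | (z, y) ∈ B} : Finset W))
      (T := ({y | (z, y) ∈ M} : Finset W)) ?_ ?_ ?_).trans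
      (Nat.mul_le_mul_left q (card_le_card ?_))
    · intro y hy y' hy' h
      simp only [hB, mem_filter, mem_univ, true_and] at hy hy'
      have := hy.2
      push Not at this
      obtain ⟨x, hx, hxz⟩ := this
      exact hU _ hx _ hy'.1 ⟨hxz, h⟩
    · intro y hy y' hy' h
      simp only [hB, hM, hA, mem_filter, mem_univ, true_and] at hy hy'
      obtain ⟨x, ⟨hx, -⟩, hxz⟩ := hy'
      exact hU _ hx _ hy.1 ⟨hxz, h.symm⟩
    · rw [Finset.disjoint_left]
      intro y hy hy'
      simp only [hB, hM, hA, mem_filter, mem_univ, true_and] at hy hy'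
      obtain ⟨x, ⟨hx, hx'⟩, hxz⟩ := hy'
      exact hx' z hy.1 hxz.symm
    · intro y hy
      obtain ⟨y', hy', hyy⟩ := mem_nbhd.1 hy
      simp only [hB, hM, hA, mem_union, mem_filter, mem_univ, true_and] at hy' ⊢
      rw [mem_nbhd]
      rcases hy' with ⟨-, h⟩ | ⟨x, ⟨hx, -⟩, hxz⟩
      · push Not at h
        obtain ⟨x, hx, hxz⟩ := h
        exact ⟨(x, y'), hx, hxz, hyy⟩
      · exact ⟨(x, y'), hx, hxz, hyy⟩
  rw [← hAB]
  linarith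

theorem Expands.of_iso {p q : ℕ} {G : SimpleGraph V} {H : SimpleGraph W} (e : G ≃g H)
    (hH : Expands p q H) : Expands p q G := by
  intro U hU
  have h := hH (U.map e.toEquiv.toEmbedding) (by
    intro x' hx' y' hy' hxy
    obtain ⟨x, hx, rfl⟩ := Finset.mem_map.1 hx'
    obtain ⟨y, hy, rfl⟩ := Finset.mem_map.1 hy'
    exact hU x hx y hy (e.map_rel_iff'.1 hxy))
  have hN : nbhd H (U.map e.toEquiv.toEmbedding) = (nbhd G U).map e.toEquiv.toEmbedding := by
    ext y
    obtain ⟨y, rfl⟩ := e.toEquiv.surjective y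
    simp only [mem_nbhd, Finset.mem_map, Equiv.coe_toEmbedding]
    constructor
    · rintro ⟨_, ⟨u, hu, rfl⟩, h⟩
      exact ⟨y, ⟨u, hu, e.map_rel_iff'.1 h⟩, rfl⟩
    · rintro ⟨y', ⟨u, hu, h⟩, hy⟩
      obtain rfl := e.toEquiv.injective hy
      exact ⟨_, ⟨u, hu, rfl⟩, e.map_rel_iff'.2 h⟩
  rwa [hN, card_map, card_map] at h

theorem Expands.tensorPow {p q : ℕ} (hqp : q ≤ p) {G : SimpleGraph V} (hG : Expands p q G)
    {k : ℕ} (hk : 1 ≤ k) : Expands p q (tensorPow G k) := by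
  induction k, hk using Nat.le_induction with
  | base => exact hG.of_iso (tensorPowOne G)
  | succ k hk ih => exact (hG.tensorProd hqp ih).of_iso (tensorPowSucc G hk)

theorem Expands.indepNum_le {p q : ℕ} {G : SimpleGraph V} (hG : Expands p q G) :
    (p + q) * G.indepNum ≤ q * Fintype.card V := by
  obtain ⟨U, hU, hc⟩ := exists_indep_card G
  have h₁ := hG U hU
  have h₂ := Nat.mul_le_mul_left q hU.card_add_card_nbhd_le
  rw [← hc]
  linarith

/-- With R the vertices outside U ∪ N(U) and I a maximum independent set of the k-th power, U × V^k
∪ R × I is independent, because U has no edges to U or to R. -/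
theorem indepNum_tensorPow_succ_ge (G : SimpleGraph V) {U : Finset V} (hU : Indep G U)
    {k : ℕ} (hk : 1 ≤ k) :
    #U * Fintype.card V ^ k
      + (Fintype.card V - (#U + #(nbhd G U))) * (tensorPow G k).indepNum
      ≤ (tensorPow G (k + 1)).indepNum := by
  obtain ⟨I, hI, hc⟩ := exists_indep_card (tensorPow G k)
  set R : Finset V := (U ∪ nbhd G U)ᶜ with hR
  have hd : Disjoint U (nbhd G U) := by
    rw [Finset.disjoint_left]
    intro v hv hv'
    obtain ⟨u, hu, huv⟩ := mem_nbhd.1 hv'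
    exact hU u hu v hv huv
  have hRc : #R = Fintype.card V - (#U + #(nbhd G U)) := by
    rw [hR, card_compl, card_union_of_disjoint hd]
  set J : Finset (V × (Fin k → V)) := U ×ˢ univ ∪ R ×ˢ I with hJ
  have hJc : #J = #U * Fintype.card V ^ k + #R * #I := by
    rw [hJ, card_union_of_disjoint, card_product, card_product]
    · simp
    · rw [Finset.disjoint_left]
      rintro ⟨x, y⟩ h₁ h₂
      simp only [mem_product, hR, mem_compl, mem_union] at h₁ h₂
      exact h₂.1 (Or.inl h₁.1)
  have hJi : Indep (tensorProd G (tensorPow G k)) J := by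
    rintro ⟨x, f⟩ h₁ ⟨y, g⟩ h₂ ⟨hxy, hfg⟩
    simp only [hJ, mem_union, mem_product, hR, mem_compl, mem_univ, and_true] at h₁ h₂
    rcases h₁ with h₁ | h₁ <;> rcases h₂ with h₂ | h₂
    · exact hU x h₁ y h₂ hxy
    · exact h₂.1 (Or.inr (mem_nbhd.2 ⟨x, h₁, hxy⟩))
    · exact h₁.1 (Or.inr (mem_nbhd.2 ⟨y, h₂, hxy.symm⟩))
    · exact hI f h₁.2 g h₂.2 hfg
  let e := (tensorPowSucc G (k := k) hk).symm
  have hK : Indep (tensorPow G (k + 1)) (J.map e.toEquiv.toEmbedding) := by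
    intro x' hx' y' hy' hxy
    obtain ⟨x, hx, rfl⟩ := Finset.mem_map.1 hx'
    obtain ⟨y, hy, rfl⟩ := Finset.mem_map.1 hy'
    exact hJi x hx y hy (e.map_rel_iff'.1 hxy)
  have := hK.card_le
  rwa [card_map, hJc, hRc, hc] at this

theorem indepRatio_tensorPow (G : SimpleGraph V) (k : ℕ) :
    indepRatio (tensorPow G k) = ((tensorPow G k).indepNum : ℝ) / (Fintype.card V : ℝ) ^ k := by
  simp [indepRatio]

/-- If the ratio `|N(U)| / |U|` attains its minimum `p / q ≥ 1`, the tensor capacity is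
`q / (p + q)`. -/
theorem isTensorCapacity_of_expands [Nonempty V] {p q : ℕ} (hq : 1 ≤ q) (hqp : q ≤ p)
    {G : SimpleGraph V} (hG : Expands p q G) {U : Finset V} (hU : Indep G U) (hU₀ : U.Nonempty)
    (h : p * #U = q * #(nbhd G U)) : IsTensorCapacity G ((q : ℝ) / ((p + q : ℕ) : ℝ)) := by
  set n : ℝ := (Fintype.card V : ℝ) with hn
  have hn₀ : 0 < n := by
    rw [hn]; exact_mod_cast Fintype.card_pos
  set c : ℝ := (q : ℝ) / ((p + q : ℕ) : ℝ) with hc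
  -- The fraction of vertices outside U ∪ N(U); each further factor shrinks the distance to the
  -- limit by at least this factor.
  set ρ : ℝ := 1 - ((#U : ℝ) + #(nbhd G U)) / n with hρ
  have hpq : (0 : ℝ) < ((p + q : ℕ) : ℝ) := by exact_mod_cast (by omega : 0 < p + q)
  have hUpos : (0 : ℝ) < #U := by exact_mod_cast hU₀.card_pos
  have hle : (#U : ℝ) + #(nbhd G U) ≤ n := by
    rw [hn]
    exact_mod_cast hU.card_add_card_nbhd_le
  have hρ₀ : 0 ≤ ρ := by
    rw [hρ, sub_nonneg, div_le_one hn₀]; exact hle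
  have hρ₁ : ρ < 1 := by
    have : 0 < ((#U : ℝ) + #(nbhd G U)) / n := by positivity
    linarith
  have hcU : c * ((#U : ℝ) + #(nbhd G U)) = #U := by
    rw [hc, div_mul_eq_mul_div, div_eq_iff hpq.ne']
    have : (p : ℝ) * #U = q * #(nbhd G U) := by exact_mod_cast h
    push_cast
    linarith
  have hupper : ∀ k, 1 ≤ k → indepRatio (tensorPow G k) ≤ c := by
    intro k hk
    have := (hG.tensorPow hqp hk).indepNum_le
    rw [indepRatio_tensorPow, div_le_iff₀ (by positivity), hc, div_mul_eq_mul_div,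
      le_div_iff₀ hpq, mul_comm]
    rw [Fintype.card_fun, Fintype.card_fin] at this
    exact_mod_cast this
  have hstep : ∀ k, 1 ≤ k →
      c - indepRatio (tensorPow G (k + 1)) ≤ ρ * (c - indepRatio (tensorPow G k)) := by
    intro k hk
    have h₁ := indepNum_tensorPow_succ_ge G hU hk
    have h₂ : (#U : ℝ) * n ^ k + (n - (#U + #(nbhd G U))) * (tensorPow G k).indepNum
        ≤ (tensorPow G (k + 1)).indepNum := by
      have : ((Fintype.card V - (#U + #(nbhd G U)) : ℕ) : ℝ) = n - (#U + #(nbhd G U)) := by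
        rw [Nat.cast_sub hU.card_add_card_nbhd_le]
        push_cast
        rfl
      rw [← this, hn]
      exact_mod_cast h₁
    have h₃ : (#U : ℝ) / n + ρ * indepRatio (tensorPow G k)
        ≤ indepRatio (tensorPow G (k + 1)) := by
      rw [indepRatio_tensorPow, indepRatio_tensorPow, ← hn, le_div_iff₀ (by positivity), hρ]
      refine le_of_eq_of_le ?_ h₂
      field_simp
      ring
    have h₄ : c - ρ * c = #U / n := by
      have : (#U : ℝ) / n = c * ((#U : ℝ) + #(nbhd G U)) / n := by rw [hcU]
      rw [this, hρ]
      ring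
    linarith
  have hgeom : ∀ k, c - indepRatio (tensorPow G (k + 1)) ≤ ρ ^ k * c := by
    intro k
    induction k with
    | zero =>
      have : 0 ≤ indepRatio (tensorPow G 1) := by
        unfold indepRatio; positivity
      simp only [pow_zero, one_mul]
      linarith
    | succ k ih =>
      calc _ ≤ ρ * (c - indepRatio (tensorPow G (k + 1))) := hstep (k + 1) (by omega)
        _ ≤ ρ * (ρ ^ k * c) := mul_le_mul_of_nonneg_left ih hρ₀
        _ = _ := by ring
  unfold IsTensorCapacity
  -- The power k = 0 is a single vertex of ratio 1, which violates the upper bound, so the sequence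
  -- is shifted.
  rw [← tendsto_add_atTop_iff_nat 1]
  have hlim : Tendsto (fun k : ℕ => c - ρ ^ k * c) atTop (𝓝 c) := by
    simpa using ((tendsto_pow_atTop_nhds_zero_of_lt_one hρ₀ hρ₁).mul_const c).const_sub c
  refine tendsto_of_tendsto_of_tendsto_of_le_of_le hlim tendsto_const_nhds ?_ ?_
  · intro k
    have := hgeom k
    show c - ρ ^ k * c ≤ _
    linarith
  · intro k
    exact hupper (k + 1) (by omega)

/-- If some independent set is larger than its neighbourhood, the tensor capacity is `1`. -/
theorem isTensorCapacity_one [Nonempty V] {G : SimpleGraph V} {U : Finset V} (hU : Indep G U)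
    (h : #(nbhd G U) < #U) : IsTensorCapacity G 1 := by
  set n : ℝ := (Fintype.card V : ℝ) with hn
  have hn₀ : 0 < n := by
    rw [hn]; exact_mod_cast Fintype.card_pos
  set u : ℝ := (#U : ℝ) with hu
  set m : ℝ := (#(nbhd G U) : ℝ) with hm
  have hmu : m < u := by rw [hm, hu]; exact_mod_cast h
  have hm₀ : 0 ≤ m := by positivity
  have hu₀ : 0 < u := hm₀.trans_lt hmu
  -- The midpoint of m/u and 1. Weight l on U and 1/l on N(U) keeps edge products at least 1, and
  -- any l strictly between m/u and 1 brings the total below n.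
  set l : ℝ := (m + u) / (2 * u) with hl
  have hl₀ : 0 < l := by positivity
  have hl₁ : l < 1 := by rw [hl, div_lt_one (by positivity)]; linarith
  set c : V → ℝ := fun v => if v ∈ U then l else if v ∈ nbhd G U then l⁻¹ else 1 with hc
  have hlinv : 1 ≤ l⁻¹ := (one_le_inv₀ hl₀).2 hl₁.le
  have hc₀ : ∀ v, 0 < c v := by
    intro v
    simp only [hc]
    split_ifs <;> positivity
  have hc₁ : ∀ v, v ∉ U → 1 ≤ c v := by
    intro v hv
    simp only [hc, if_neg hv]
    split_ifs
    · exact hlinv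
    · exact le_rfl
  have hcU : ∀ v w, v ∈ U → G.Adj v w → 1 ≤ c v * c w := by
    intro v w hv hvw
    have hw : w ∉ U := fun hw => hU v hv w hw hvw
    have hw' : w ∈ nbhd G U := mem_nbhd.2 ⟨v, hv, hvw⟩
    simp only [hc, if_pos hv, if_neg hw, if_pos hw']
    rw [mul_inv_cancel₀ hl₀.ne']
  have hcadj : ∀ v w, G.Adj v w → 1 ≤ c v * c w := by
    intro v w hvw
    by_cases hv : v ∈ U
    · exact hcU v w hv hvw
    by_cases hw : w ∈ U
    · rw [mul_comm]; exact hcU w v hw hvw.symm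
    · exact one_le_mul_of_one_le_of_one_le (hc₁ v hv) (hc₁ w hw)
  set σ : ℝ := ∑ v, c v with hσ
  have hσ₀ : 0 ≤ σ := sum_nonneg fun v _ => (hc₀ v).le
  have hσn : σ < n := by
    have hcs : ∀ v, c v = 1 + (if v ∈ U then (l - 1) else 0)
        + (if v ∈ nbhd G U then (l⁻¹ - 1) else 0) := by
      intro v
      by_cases hv : v ∈ U
      · have hv' : v ∉ nbhd G U := by
          intro hv'
          obtain ⟨w, hw, hwv⟩ := mem_nbhd.1 hv'
          exact hU w hw v hv hwv
        simp [hc, hv, hv']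
      · simp only [hc, if_neg hv]
        split_ifs <;> ring
    have hσ' : σ = n + u * (l - 1) + m * (l⁻¹ - 1) := by
      rw [hσ, sum_congr rfl fun v _ => hcs v, sum_add_distrib, sum_add_distrib]
      simp [hn, hu, hm]
      ring
    have hul : u * l = (m + u) / 2 := by rw [hl]; field_simp
    have hkey : u * (l - 1) + m * (l⁻¹ - 1) = (l - 1) * (u * l - m) / l := by
      field_simp
      ring
    have : (l - 1) * (u * l - m) / l < 0 :=
      div_neg_of_neg_of_pos (mul_neg_of_neg_of_pos (by linarith) (by linarith)) hl₀
    linarith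
  have hlower : ∀ k, 1 ≤ k → 1 - (σ / n) ^ k ≤ indepRatio (tensorPow G k) := by
    intro k hk
    -- For adjacent tuples the two weight products multiply to at least 1, so they cannot both be
    -- below 1.
    set I : Finset (Fin k → V) := {x | ∏ i, c (x i) < 1} with hI
    have hIi : Indep (tensorPow G k) I := by
      intro x hx y hy hxy
      simp only [hI, mem_filter, mem_univ, true_and] at hx hy
      rw [tensorPow_adj G hk] at hxy
      have h₁ : 1 ≤ ∏ i, c (x i) * c (y i) := by
        have := prod_le_prod (s := (univ : Finset (Fin k))) (f := fun _ => (1 : ℝ))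
          (fun _ _ => zero_le_one) (fun i _ => hcadj _ _ (hxy i))
        simpa using this
      rw [prod_mul_distrib] at h₁
      have h₂ : 0 ≤ ∏ i, c (x i) := prod_nonneg fun i _ => (hc₀ _).le
      have h₃ : 0 ≤ ∏ i, c (y i) := prod_nonneg fun i _ => (hc₀ _).le
      nlinarith
    -- Markov's inequality: every tuple outside I has weight at least 1, and all tuples together
    -- weigh σ^k.
    have hIc : (#Iᶜ : ℝ) ≤ σ ^ k := by
      calc (#Iᶜ : ℝ) = ∑ x ∈ Iᶜ, (1 : ℝ) := by simp
        _ ≤ ∑ x ∈ Iᶜ, ∏ i, c (x i) := by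
          refine sum_le_sum fun x hx => ?_
          simpa [hI] using hx
        _ ≤ ∑ x : Fin k → V, ∏ i, c (x i) :=
          sum_le_sum_of_subset_of_nonneg (subset_univ _)
            fun x _ _ => prod_nonneg fun i _ => (hc₀ _).le
        _ = ∏ _i : Fin k, ∑ v, c v := (Fintype.prod_sum fun (_ : Fin k) v => c v).symm
        _ = σ ^ k := by simp [hσ]
    have hcard : (#I : ℝ) + #Iᶜ = n ^ k := by
      have := card_add_card_compl I
      rw [Fintype.card_fun, Fintype.card_fin] at this
      rw [hn]
      exact_mod_cast this
    have hle : (#I : ℝ) ≤ (tensorPow G k).indepNum := by exact_mod_cast hIi.card_le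
    rw [indepRatio_tensorPow, ← hn, le_div_iff₀ (by positivity), div_pow, sub_mul,
      div_mul_cancel₀ _ (by positivity)]
    linarith
  have hupper : ∀ k, indepRatio (tensorPow G k) ≤ 1 := by
    intro k
    obtain ⟨I, -, hc⟩ := exists_indep_card (tensorPow G k)
    rw [indepRatio, Nat.card_eq_fintype_card, ← hc]
    apply div_le_one_of_le₀ _ (by positivity)
    exact_mod_cast card_le_univ I
  unfold IsTensorCapacity
  rw [← tendsto_add_atTop_iff_nat 1]
  have hlim : Tendsto (fun k : ℕ => 1 - (σ / n) ^ (k + 1)) atTop (𝓝 1) := by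
    have := tendsto_pow_atTop_nhds_zero_of_lt_one (div_nonneg hσ₀ hn₀.le)
      ((div_lt_one hn₀).2 hσn)
    simpa using ((tendsto_add_atTop_iff_nat 1).2 this).const_sub 1
  exact tendsto_of_tendsto_of_tendsto_of_le_of_le hlim tendsto_const_nhds
    (fun k => hlower (k + 1) (by omega)) (fun k => hupper (k + 1))

/-- `p / q` is the minimum of `|N(U)| / |U|` over the nonempty independent sets `U`. -/
def IsMinRatio (G : SimpleGraph V) (p q : ℕ) : Prop :=
  Expands p q G ∧ ∃ U, Indep G U ∧ U.Nonempty ∧ p * #U = q * #(nbhd G U)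

/-- The sizes |N(U)| and |U| of a minimiser serve as p and q, which confines the search to pairs of
numbers up to |V|. -/
theorem isTensorCapacity_one_or_exists_isMinRatio [Nonempty V] (G : SimpleGraph V) :
    IsTensorCapacity G 1 ∨
      ∃ p q, 1 ≤ q ∧ q ≤ p ∧ p ≤ Fintype.card V ∧ IsMinRatio G p q := by
  by_cases h : ∃ U, Indep G U ∧ #(nbhd G U) < #U
  · obtain ⟨U, hU, hlt⟩ := h
    exact Or.inl (isTensorCapacity_one hU hlt)
  right
  push Not at h
  obtain ⟨v⟩ := ‹Nonempty V›
  obtain ⟨U, hU, hmin⟩ := exists_min_image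
    (univ.filter fun U : Finset V => Indep G U ∧ U.Nonempty)
    (fun U => (#(nbhd G U) : ℚ) / #U)
    ⟨{v}, by
      simp only [mem_filter, mem_univ, true_and, singleton_nonempty, and_true]
      intro x hx y hy hxy
      rw [mem_singleton.1 hx, mem_singleton.1 hy] at hxy
      exact G.irrefl hxy⟩
  simp only [mem_filter, mem_univ, true_and] at hU hmin
  refine ⟨#(nbhd G U), #U, hU.2.card_pos, h U hU.1, card_le_univ _, ?_, U, hU.1, hU.2,
    mul_comm _ _⟩
  intro T hT
  rcases T.eq_empty_or_nonempty with rfl | hT₀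
  · simp
  have := hmin T ⟨hT, hT₀⟩
  rw [div_le_div_iff₀ (by exact_mod_cast hU.2.card_pos) (by exact_mod_cast hT₀.card_pos)] at this
  rw [mul_comm #U]
  exact_mod_cast this

end Capacity

/-! ### Splittings and twins in cographs -/

section Cograph
open Classical

variable {V : Type*}

/-- The relation `R` has no induced path on four vertices. -/
def P4Free (R : V → V → Prop) : Prop :=
  ∀ a b c d, a ≠ b → a ≠ c → a ≠ d → b ≠ c → b ≠ d → c ≠ d →
    R a b → R b c → R c d → R a c ∨ R b d ∨ R a d

/-- The path on four vertices is self-complementary: if a, b, c, d is a path in the complement, then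
c, a, d, b is one in R. -/
theorem P4Free.not {R : V → V → Prop} (hs : ∀ x y, R x y → R y x) (h : P4Free R) :
    P4Free fun x y => ¬R x y := by
  intro a b c d hab hac had hbc hbd hcd h₁ h₂ h₃
  by_contra hc
  push Not at hc
  obtain ⟨hac', hbd', had'⟩ := hc
  rcases h c a d b hac.symm hcd hbc.symm had hab hbd.symm (hs _ _ hac') had' (hs _ _ hbd')
    with h | h | h
  · exact h₃ h
  · exact h₁ h
  · exact h₂ (hs _ _ h)

theorem IsCograph.p4Free {G : SimpleGraph V} (h : IsCograph G) : P4Free G.Adj := by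
  intro a b c d hab hac had hbc hbd hcd h₁ h₂ h₃
  by_contra hc
  push Not at hc
  obtain ⟨hac', hbd', had'⟩ := hc
  refine h.false ⟨⟨![a, b, c, d], ?_⟩, ?_⟩
  · intro i j hij
    fin_cases i <;> fin_cases j <;> simp_all
  · intro i j
    have h₁' := h₁.symm
    have h₂' := h₂.symm
    have h₃' := h₃.symm
    have hac'' := fun h => hac' (G.symm.symm _ _ h)
    have hbd'' := fun h => hbd' (G.symm.symm _ _ h)
    have had'' := fun h => had' (G.symm.symm _ _ h)
    change G.Adj (![a, b, c, d] i) (![a, b, c, d] j) ↔ _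
    fin_cases i <;> fin_cases j <;> simp_all [SimpleGraph.pathGraph_adj]

/-- `S` is the union of two disjoint nonempty sets with all or none of the pairs between them
related. -/
def Splits (R : V → V → Prop) (S : Finset V) : Prop :=
  ∃ A B : Finset V, A.Nonempty ∧ B.Nonempty ∧ Disjoint A B ∧ A ∪ B = S ∧
    ((∀ a ∈ A, ∀ b ∈ B, R a b) ∨ ∀ a ∈ A, ∀ b ∈ B, ¬R a b)

theorem Splits.of_not {R : V → V → Prop} {S : Finset V} (h : Splits (fun x y => ¬R x y) S) :
    Splits R S := by
  obtain ⟨A, B, hA, hB, hd, hu, h | h⟩ := h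
  · exact ⟨A, B, hA, hB, hd, hu, Or.inr h⟩
  · exact ⟨A, B, hA, hB, hd, hu, Or.inl fun a ha b hb => not_not.1 (h a ha b hb)⟩

/-- If v has no neighbour in B, it joins A. If it has a neighbour c in B, then no x ∈ A ∩ N(v) is
related to a y ∈ A \ N(v), as c, v, x, y would be an induced path; so A \ N(v), which contains b, is
separated from everything else. -/
theorem splits_insert_of_not_rel {R : V → V → Prop} (hs : ∀ x y, R x y → R y x) (hR : P4Free R)
    {A B : Finset V} (hB : B.Nonempty) (hd : Disjoint A B)
    (hAB : ∀ a ∈ A, ∀ b ∈ B, ¬R a b) {v : V} (hv : v ∉ A ∪ B) {b : V} (hb : b ∈ A)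
    (hvb : ¬R v b) : Splits R (insert v (A ∪ B)) := by
  rw [mem_union, not_or] at hv
  by_cases hc : ∃ c ∈ B, R v c
  swap
  · push Not at hc
    refine ⟨insert v A, B, insert_nonempty _ _, hB, ?_, ?_, Or.inr ?_⟩
    · rw [disjoint_insert_left]
      exact ⟨hv.2, hd⟩
    · rw [insert_union]
    · intro x hx y hy
      rcases mem_insert.1 hx with rfl | hx
      · exact hc y hy
      · exact hAB x hx y hy
  obtain ⟨c, hcB, hvc⟩ := hc
  by_cases he : ∃ x ∈ A, ∃ y ∈ A, R v x ∧ ¬R v y ∧ R x y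
  · obtain ⟨x, hx, y, hy, hvx, hvy, hxy⟩ := he
    have hcA : c ∉ A := fun h => Finset.disjoint_left.1 hd h hcB
    rcases hR c v x y (fun h => hv.2 (h ▸ hcB)) (fun h => hcA (h ▸ hx)) (fun h => hcA (h ▸ hy))
      (fun h => hv.1 (h ▸ hx)) (fun h => hv.1 (h ▸ hy)) (fun h => hvy (h ▸ hvx))
      (hs _ _ hvc) hvx hxy with h | h | h
    · exact absurd (hs _ _ h) (hAB x hx c hcB)
    · exact absurd h hvy
    · exact absurd (hs _ _ h) (hAB y hy c hcB)
  push Not at he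
  refine ⟨A.filter fun y => ¬R v y, insert v (A.filter (R v) ∪ B), ⟨b, mem_filter.2 ⟨hb, hvb⟩⟩,
    insert_nonempty _ _, ?_, ?_, Or.inr ?_⟩
  · rw [Finset.disjoint_left]
    intro y hy hy'
    obtain ⟨hyA, hvy⟩ := mem_filter.1 hy
    rcases mem_insert.1 hy' with rfl | hy'
    · exact hv.1 hyA
    rcases mem_union.1 hy' with hy' | hy'
    · exact hvy (mem_filter.1 hy').2
    · exact Finset.disjoint_left.1 hd hyA hy'
  · ext y
    simp only [mem_union, mem_insert, mem_filter]
    tauto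
  · intro y hy x hx
    obtain ⟨hyA, hvy⟩ := mem_filter.1 hy
    rcases mem_insert.1 hx with rfl | hx
    · exact fun h => hvy (hs _ _ h)
    rcases mem_union.1 hx with hx | hx
    · obtain ⟨hxA, hvx⟩ := mem_filter.1 hx
      exact fun h => he x hxA y hyA hvx hvy (hs _ _ h)
    · exact hAB y hyA x hx

theorem splits_insert {R : V → V → Prop} (hs : ∀ x y, R x y → R y x) (hR : P4Free R)
    {A B : Finset V} (hA : A.Nonempty) (hB : B.Nonempty) (hd : Disjoint A B)
    (hAB : ∀ a ∈ A, ∀ b ∈ B, ¬R a b) {v : V} (hv : v ∉ A ∪ B) :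
    Splits R (insert v (A ∪ B)) := by
  by_cases h : ∀ x ∈ A ∪ B, R v x
  · refine ⟨{v}, A ∪ B, singleton_nonempty v, hA.mono subset_union_left, ?_, rfl, Or.inl ?_⟩
    · rwa [disjoint_singleton_left]
    · intro x hx y hy
      rw [mem_singleton.1 hx]
      exact h y hy
  push Not at h
  obtain ⟨b, hb, hvb⟩ := h
  rcases mem_union.1 hb with hb | hb
  · exact splits_insert_of_not_rel hs hR hB hd hAB hv hb hvb
  · rw [union_comm] at hv ⊢
    exact splits_insert_of_not_rel hs hR hA hd.symm (fun x hx y hy h => hAB y hy x hx (hs _ _ h))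
      hv hb hvb

/-- Add the vertices one at a time. A splitting of join type becomes one of union type in the
complement, which is again P4-free, so only the latter has to be extended. -/
theorem P4Free.splits {R : V → V → Prop} (hs : ∀ x y, R x y → R y x) (hR : P4Free R)
    (S : Finset V) (hS : 2 ≤ #S) : Splits R S := by
  induction S using Finset.induction_on with
  | empty => simp at hS
  | insert v S hv ih =>
    rw [card_insert_of_notMem hv] at hS
    rcases Nat.lt_or_ge (#S) 2 with h | h
    · obtain ⟨w, rfl⟩ := card_eq_one.1 (by omega : #S = 1)
      refine ⟨{v}, {w}, singleton_nonempty v, singleton_nonempty w, ?_, rfl, ?_⟩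
      · simpa using hv
      · simpa using _root_.em (R v w)
    · obtain ⟨A, B, hA, hB, hd, rfl, h | h⟩ := ih h
      · exact Splits.of_not (splits_insert (fun x y h h' => h (hs _ _ h')) (hR.not hs) hA hB hd
          (fun a ha b hb => not_not.2 (h a ha b hb)) hv)
      · exact splits_insert hs hR hA hB hd h hv

/-- `x` and `y` have the same neighbours in `S`, apart from `x` and `y`. -/
def Twins (R : V → V → Prop) (S : Finset V) (x y : V) : Prop :=
  ∀ z ∈ S, z ≠ x → z ≠ y → (R z x ↔ R z y)

/-- In a splitting, twins inside one part are twins in S, since the other part is related to both or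
to neither. If both parts are singletons, their elements are twins vacuously. -/
theorem P4Free.exists_twins {R : V → V → Prop} (hs : ∀ x y, R x y → R y x) (hR : P4Free R)
    (S : Finset V) (hS : 2 ≤ #S) : ∃ x ∈ S, ∃ y ∈ S, x ≠ y ∧ Twins R S x y := by
  induction S using Finset.strongInduction with
  | H S ih =>
    obtain ⟨A, B, hA, hB, hd, hu, hAB⟩ := hR.splits hs S hS
    have key : ∀ A B : Finset V, B.Nonempty → Disjoint A B → A ∪ B = S →
        ((∀ a ∈ A, ∀ b ∈ B, R a b) ∨ ∀ a ∈ A, ∀ b ∈ B, ¬R a b) → 2 ≤ #A →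
        ∃ x ∈ S, ∃ y ∈ S, x ≠ y ∧ Twins R S x y := by
      intro A B hB hd hu hAB hA₂
      have hAS : A ⊂ S := by
        rw [← hu]
        refine ⟨subset_union_left, fun h => ?_⟩
        obtain ⟨b, hb⟩ := hB
        exact Finset.disjoint_left.1 hd (h (mem_union_right _ hb)) hb
      obtain ⟨x, hx, y, hy, hxy, ht⟩ := ih A hAS hA₂
      refine ⟨x, hAS.1 hx, y, hAS.1 hy, hxy, fun z hz hzx hzy => ?_⟩
      rw [← hu] at hz
      rcases mem_union.1 hz with hz | hz
      · exact ht z hz hzx hzy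
      · rcases hAB with h | h
        · exact iff_of_true (hs _ _ (h x hx z hz)) (hs _ _ (h y hy z hz))
        · exact iff_of_false (fun h' => h x hx z hz (hs _ _ h'))
            (fun h' => h y hy z hz (hs _ _ h'))
    rcases Nat.lt_or_ge #A 2 with hA₂ | hA₂
    · rcases Nat.lt_or_ge #B 2 with hB₂ | hB₂
      · obtain ⟨a, rfl⟩ := card_eq_one.1 (by have := hA.card_pos; omega : #A = 1)
        obtain ⟨b, rfl⟩ := card_eq_one.1 (by have := hB.card_pos; omega : #B = 1)
        subst hu
        refine ⟨a, by simp, b, by simp, by simpa using hd, fun z hz hza hzb => ?_⟩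
        simp only [mem_union, mem_singleton] at hz
        tauto
      · exact key B A hA hd.symm (by rwa [union_comm])
          (hAB.imp (fun h x hx y hy => hs _ _ (h y hy x hx))
            (fun h x hx y hy h' => h y hy x hx (hs _ _ h'))) hB₂
    · exact key A B hB hd hu hAB hA₂

end Cograph

/-! ### Maximising P|U| - Q|N(U)| over unions and joins -/

section Value
open Classical

variable {V : Type*}

/-- The vertices of `M` that have a neighbour in `U`. -/
noncomputable def nbhdIn (G : SimpleGraph V) (M U : Finset V) : Finset V :=
  M.filter fun v => ∃ u ∈ U, G.Adj u v

theorem nbhdIn_subset (G : SimpleGraph V) (M U : Finset V) : nbhdIn G M U ⊆ M :=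
  filter_subset _ _

/-- `h` is the maximum of `P |U| - Q |N(U)|` over the independent sets `U` of the subgraph induced
on `M`. -/
def IsValue (G : SimpleGraph V) (P Q : ℕ) (M : Finset V) (h : ℕ) : Prop :=
  (∀ U ⊆ M, Indep G U → P * #U ≤ Q * #(nbhdIn G M U) + h) ∧
    ∃ U ⊆ M, Indep G U ∧ P * #U = Q * #(nbhdIn G M U) + h

theorem isValue_singleton (G : SimpleGraph V) (P Q : ℕ) (v : V) : IsValue G P Q {v} P := by
  constructor
  · intro U hU _
    have := Nat.mul_le_mul_left P (card_le_card hU)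
    rw [card_singleton, mul_one] at this
    omega
  · have hI : Indep G {v} := by
      intro x hx y hy hxy
      rw [mem_singleton.1 hx, mem_singleton.1 hy] at hxy
      exact G.irrefl hxy
    refine ⟨{v}, Subset.rfl, hI, ?_⟩
    have : nbhdIn G {v} {v} = ∅ := by
      rw [nbhdIn, filter_eq_empty_iff]
      rintro x hx ⟨u, hu, h⟩
      exact hI u hu x hx h
    simp [this]

theorem Indep.mono {G : SimpleGraph V} {S T : Finset V} (hT : Indep G T) (h : S ⊆ T) :
    Indep G S :=
  fun x hx y hy => hT x (h hx) y (h hy)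

theorem IsValue.union_of_not_adj [DecidableEq V] {G : SimpleGraph V} {P Q : ℕ} {A B : Finset V} {a b : ℕ}
    (hA : IsValue G P Q A a) (hB : IsValue G P Q B b) (hd : Disjoint A B)
    (h : ∀ x ∈ A, ∀ y ∈ B, ¬G.Adj x y) : IsValue G P Q (A ∪ B) (a + b) := by
  have hN : ∀ S ⊆ A, ∀ T ⊆ B,
      #(nbhdIn G (A ∪ B) (S ∪ T)) = #(nbhdIn G A S) + #(nbhdIn G B T) := by
    intro S hS T hT
    rw [← card_union_of_disjoint (hd.mono (nbhdIn_subset G A S) (nbhdIn_subset G B T))]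
    congr 1
    ext v
    simp only [nbhdIn, mem_filter, mem_union]
    constructor
    · rintro ⟨hv | hv, u, hu | hu, huv⟩
      · exact Or.inl ⟨hv, u, hu, huv⟩
      · exact absurd huv.symm (h v hv u (hT hu))
      · exact absurd huv (h u (hS hu) v hv)
      · exact Or.inr ⟨hv, u, hu, huv⟩
    · rintro (⟨hv, u, hu, huv⟩ | ⟨hv, u, hu, huv⟩)
      · exact ⟨Or.inl hv, u, Or.inl hu, huv⟩
      · exact ⟨Or.inr hv, u, Or.inr hu, huv⟩
  constructor
  · intro U hU hI
    have hUe : U = (U ∩ A) ∪ (U ∩ B) := by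
      rw [← inter_union_distrib_left, inter_eq_left.2 hU]
    have hUd : Disjoint (U ∩ A) (U ∩ B) := hd.mono inter_subset_right inter_subset_right
    have h₁ := hA.1 _ inter_subset_right (hI.mono (inter_subset_left (s₂ := A)))
    have h₂ := hB.1 _ inter_subset_right (hI.mono (inter_subset_left (s₂ := B)))
    rw [hUe, hN _ inter_subset_right _ inter_subset_right, card_union_of_disjoint hUd]
    linarith
  · obtain ⟨S, hS, hSI, hSe⟩ := hA.2
    obtain ⟨T, hT, hTI, hTe⟩ := hB.2
    refine ⟨S ∪ T, union_subset_union hS hT, ?_, ?_⟩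
    · intro x hx y hy hxy
      rcases mem_union.1 hx with hx | hx <;> rcases mem_union.1 hy with hy | hy
      · exact hSI x hx y hy hxy
      · exact h x (hS hx) y (hT hy) hxy
      · exact h y (hS hy) x (hT hx) hxy.symm
      · exact hTI x hx y hy hxy
    · rw [hN S hS T hT, card_union_of_disjoint (hd.mono hS hT)]
      linarith

theorem card_nbhdIn_union_of_adj [DecidableEq V] {G : SimpleGraph V} {A B : Finset V} (hd : Disjoint A B)
    (h : ∀ x ∈ A, ∀ y ∈ B, G.Adj x y) {S : Finset V} (hS : S ⊆ A) (hS₀ : S.Nonempty) :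
    #(nbhdIn G (A ∪ B) S) = #(nbhdIn G A S) + #B := by
  rw [← card_union_of_disjoint (hd.mono_left (nbhdIn_subset G A S))]
  congr 1
  ext v
  simp only [nbhdIn, mem_filter, mem_union]
  constructor
  · rintro ⟨hv | hv, hu⟩
    · exact Or.inl ⟨hv, hu⟩
    · exact Or.inr hv
  · rintro (⟨hv, hu⟩ | hv)
    · exact ⟨Or.inl hv, hu⟩
    · obtain ⟨u, hu⟩ := hS₀
      exact ⟨Or.inr hv, u, hu, h u (hS hu) v hv⟩

/-- A nonempty set inside A gains all of B as neighbours and pays Q|B| more. When this exceeds the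
value of A, the empty set takes over, which is what truncated subtraction records. -/
theorem IsValue.exists_union_of_adj [DecidableEq V] {G : SimpleGraph V} {P Q : ℕ} {A B : Finset V} {a : ℕ}
    (hA : IsValue G P Q A a) (hd : Disjoint A B) (h : ∀ x ∈ A, ∀ y ∈ B, G.Adj x y) :
    ∃ U ⊆ A ∪ B, Indep G U ∧ P * #U = Q * #(nbhdIn G (A ∪ B) U) + (a - Q * #B) := by
  have h₀ : ∃ U ⊆ A ∪ B, Indep G U ∧ P * #U = Q * #(nbhdIn G (A ∪ B) U) + 0 :=
    ⟨∅, empty_subset _, by simp [Indep], by simp [nbhdIn]⟩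
  rcases Nat.lt_or_ge (Q * #B) a with hlt | hge
  · obtain ⟨U, hU, hI, he⟩ := hA.2
    refine ⟨U, hU.trans subset_union_left, hI, ?_⟩
    have hU₀ : U.Nonempty := by
      rw [nonempty_iff_ne_empty]
      rintro rfl
      rw [card_empty] at he
      omega
    rw [card_nbhdIn_union_of_adj hd h hU hU₀, mul_add]
    omega
  · rwa [Nat.sub_eq_zero_of_le hge]

/-- An independent set of a join lies entirely in one side. -/
theorem IsValue.union_of_adj [DecidableEq V] {G : SimpleGraph V} {P Q : ℕ} {A B : Finset V} {a b : ℕ}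
    (hA : IsValue G P Q A a) (hB : IsValue G P Q B b) (hd : Disjoint A B)
    (h : ∀ x ∈ A, ∀ y ∈ B, G.Adj x y) :
    IsValue G P Q (A ∪ B) (max (a - Q * #B) (b - Q * #A)) := by
  have h' : ∀ x ∈ B, ∀ y ∈ A, G.Adj x y := fun x hx y hy => (h y hy x hx).symm
  constructor
  · intro U hU hI
    rcases U.eq_empty_or_nonempty with rfl | hU₀
    · simp
    have hcase : U ⊆ A ∨ U ⊆ B := by
      by_contra hc
      rw [not_or, not_subset, not_subset] at hc
      obtain ⟨⟨x, hx, hxA⟩, y, hy, hyB⟩ := hc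
      have hxB := (mem_union.1 (hU hx)).resolve_left hxA
      have hyA := (mem_union.1 (hU hy)).resolve_right hyB
      exact hI x hx y hy (h' x hxB y hyA)
    rcases hcase with hc | hc
    · have := hA.1 U hc hI
      rw [card_nbhdIn_union_of_adj hd h hc hU₀, mul_add]
      omega
    · have := hB.1 U hc hI
      rw [union_comm, card_nbhdIn_union_of_adj hd.symm h' hc hU₀, mul_add]
      omega
  · rcases max_choice (a - Q * #B) (b - Q * #A) with he | he
    · rw [he]
      exact hA.exists_union_of_adj hd h
    · rw [he, union_comm]
      exact hB.exists_union_of_adj hd.symm h'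

theorem nbhdIn_univ [Fintype V] (G : SimpleGraph V) (U : Finset V) :
    nbhdIn G univ U = nbhd G U := by
  ext v
  simp [nbhdIn, mem_nbhd]

/-- Perturbing the weights reveals whether a maximum `0` is attained by a nonempty set. -/
theorem IsValue.isMinRatio_iff [Fintype V] {G : SimpleGraph V} {p q N h : ℕ}
    (hN : Fintype.card V < N)
    (hv : IsValue G (1 + p * N) (q * N) univ h) : IsMinRatio G p q ↔ 0 < h ∧ h < N := by
  obtain ⟨hle, U₀, -, hU₀, he⟩ := hv
  simp only [nbhdIn_univ, subset_univ, true_implies] at hle he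
  -- The quantity maximised is |U| + N(p|U| - q|N(U)|) with |U| < N. So the sign of p|U| - q|N(U)|
  -- decides the block of length N containing it, and |U| tells a nonempty set from the empty one
  -- when that difference is 0.
  have hcU : ∀ U : Finset V, #U < N := fun U => (card_le_univ U).trans_lt hN
  constructor
  · rintro ⟨hE, U, hU, hUne, hUe⟩
    constructor
    · have h₁ := hle U hU
      have h₂ : q * N * #(nbhd G U) = p * N * #U := by
        rw [mul_right_comm, ← hUe, mul_right_comm]
      have := hUne.card_pos
      rw [add_mul, h₂] at h₁
      omega
    · have h₁ := Nat.mul_le_mul_right N (hE U₀ hU₀)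
      have h₂ := hcU U₀
      have h₃ : p * N * #U₀ ≤ q * N * #(nbhd G U₀) := by
        rw [mul_right_comm, mul_right_comm q]; exact h₁
      rw [add_mul] at he
      omega
  · rintro ⟨h₀, h₁⟩
    have hE : Expands p q G := by
      intro U hU
      by_contra hc
      push Not at hc
      have h₂ := hle U hU
      have h₃ := Nat.mul_le_mul_right N (Nat.succ_le_of_lt hc)
      have h₄ : (q * #(nbhd G U)).succ * N = q * N * #(nbhd G U) + N := by
        rw [Nat.succ_mul]; ring
      have h₅ : p * #U * N = p * N * #U := by ring
      rw [add_mul] at h₂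
      omega
    refine ⟨hE, U₀, hU₀, ?_, ?_⟩
    · rw [nonempty_iff_ne_empty]
      rintro rfl
      rw [card_empty] at he
      omega
    · refine le_antisymm (hE U₀ hU₀) ?_
      by_contra hc
      push Not at hc
      have h₂ := hcU U₀
      have h₃ := Nat.mul_le_mul_right N (Nat.succ_le_of_lt hc)
      have h₄ : (p * #U₀).succ * N = p * N * #U₀ + N := by
        rw [Nat.succ_mul]; ring
      have h₅ : q * #(nbhd G U₀) * N = q * N * #(nbhd G U₀) := by ring
      rw [add_mul] at he
      omega

end Value

/-! ### Run-time calculus for programs -/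

section Machine

@[simp] theorem State.setVar_var (s : State) (x v y : ℕ) :
    (s.setVar x v).var y = if y = x then v else s.var y := by
  simp [State.setVar, Function.update_apply]

@[simp] theorem State.setVar_arr (s : State) (x v : ℕ) : (s.setVar x v).arr = s.arr := rfl

@[simp] theorem State.setArr_var (s : State) (a i v : ℕ) : (s.setArr a i v).var = s.var := rfl

@[simp] theorem State.setArr_arr (s : State) (a i v b : ℕ) :
    (s.setArr a i v).arr b = if b = a then Function.update (s.arr a) i v else s.arr b := by
  simp [State.setArr, Function.update_apply]

/-- Started on `s`, the program `c` halts within `T` steps on a memory satisfying `Q`. -/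
def Run (c : Prog) (s : State) (T : ℕ) (Q : State → Prop) : Prop :=
  ∃ t s', Exec c s t s' ∧ t ≤ T ∧ Q s'

theorem Run.mono {c : Prog} {s : State} {T T' : ℕ} {Q Q' : State → Prop} (h : Run c s T Q)
    (hT : T ≤ T') (hQ : ∀ s, Q s → Q' s) : Run c s T' Q' := by
  obtain ⟨t, s', he, ht, hq⟩ := h
  exact ⟨t, s', he, ht.trans hT, hQ s' hq⟩

theorem Run.seq {c₁ c₂ : Prog} {s : State} {T₁ T₂ : ℕ} {Q R : State → Prop}
    (h₁ : Run c₁ s T₁ R) (h₂ : ∀ s', R s' → Run c₂ s' T₂ Q) :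
    Run (.seq c₁ c₂) s (T₁ + T₂) Q := by
  obtain ⟨t₁, s₁, he₁, ht₁, hr⟩ := h₁
  obtain ⟨t₂, s₂, he₂, ht₂, hq⟩ := h₂ s₁ hr
  exact ⟨_, s₂, he₁.seq he₂, Nat.add_le_add ht₁ ht₂, hq⟩

theorem Run.ite {e : Exp} {c₁ c₂ : Prog} {s : State} {T : ℕ} {Q : State → Prop}
    (h₁ : e.eval s ≠ 0 → Run c₁ s T Q) (h₂ : e.eval s = 0 → Run c₂ s T Q) :
    Run (.ite e c₁ c₂) s (e.cost + 1 + T) Q := by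
  by_cases h : e.eval s = 0
  · obtain ⟨t, s', he, ht, hq⟩ := h₂ h
    exact ⟨_, s', .iteFalse h he, by omega, hq⟩
  · obtain ⟨t, s', he, ht, hq⟩ := h₁ h
    exact ⟨_, s', .iteTrue h he, by omega, hq⟩

/-- The program contains no loop. -/
def Prog.LoopFree : Prog → Prop
  | .skip => True
  | .assign _ _ => True
  | .put _ _ _ => True
  | .seq c₁ c₂ => c₁.LoopFree ∧ c₂.LoopFree
  | .ite _ c₁ c₂ => c₁.LoopFree ∧ c₂.LoopFree
  | .loop _ _ => False

/-- The final memory of a loop-free program. -/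
def Prog.result : Prog → State → State
  | .skip, s => s
  | .assign x e, s => s.setVar x (e.eval s)
  | .put a i e, s => s.setArr a (i.eval s) (e.eval s)
  | .seq c₁ c₂, s => c₂.result (c₁.result s)
  | .ite e c₁ c₂, s => if e.eval s = 0 then c₂.result s else c₁.result s
  | .loop _ _, s => s

/-- A bound for the number of steps of a loop-free program. -/
def Prog.bound : Prog → ℕ
  | .skip => 1
  | .assign _ e => e.cost + 1
  | .put _ i e => i.cost + e.cost + 1
  | .seq c₁ c₂ => c₁.bound + c₂.bound
  | .ite e c₁ c₂ => e.cost + 1 + (c₁.bound + c₂.bound)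
  | .loop _ _ => 0

theorem Prog.LoopFree.exec {c : Prog} (h : c.LoopFree) (s : State) :
    ∃ t ≤ c.bound, Exec c s t (c.result s) := by
  induction c generalizing s with
  | skip => exact ⟨_, le_rfl, .skip s⟩
  | assign x e => exact ⟨_, le_rfl, .assign s x e⟩
  | put a i e => exact ⟨_, le_rfl, .put s a i e⟩
  | seq c₁ c₂ ih₁ ih₂ =>
    obtain ⟨t₁, ht₁, h₁⟩ := ih₁ h.1 s
    obtain ⟨t₂, ht₂, h₂⟩ := ih₂ h.2 (c₁.result s)
    exact ⟨_, Nat.add_le_add ht₁ ht₂, h₁.seq h₂⟩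
  | ite e c₁ c₂ ih₁ ih₂ =>
    by_cases he : e.eval s = 0
    · obtain ⟨t, ht, h'⟩ := ih₂ h.2 s
      refine ⟨_, ?_, by rw [Prog.result, if_pos he]; exact .iteFalse he h'⟩
      rw [Prog.bound]
      omega
    · obtain ⟨t, ht, h'⟩ := ih₁ h.1 s
      refine ⟨_, ?_, by rw [Prog.result, if_neg he]; exact .iteTrue he h'⟩
      rw [Prog.bound]
      omega
  | loop => exact h.elim

theorem Run.of_loopFree {c : Prog} (h : c.LoopFree) {s : State} {T : ℕ} {Q : State → Prop}
    (hT : c.bound ≤ T) (hQ : Q (c.result s)) : Run c s T Q := by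
  obtain ⟨t, ht, he⟩ := h.exec s
  exact ⟨t, _, he, ht.trans hT, hQ⟩

/-- A bound for the number of steps of `m` passes through a loop body that takes `T` steps. -/
def loopTime {R : Type*} [CommSemiring R] (m T : R) : R :=
  m * (T + 4) + 4

/-- The start `lo` of the counter may be positive, as in the search where p starts at q; the time
bound nevertheless charges m passes. Each test of the guard costs 4 steps. -/
theorem Run.loop {x y : ℕ} {c : Prog} {I : ℕ → State → Prop} {T m lo : ℕ}
    (hx : ∀ k s, I k s → s.var x = k) (hy : ∀ k s, I k s → s.var y = m)
    (hc : ∀ k s, lo ≤ k → k < m → I k s → Run c s T (I (k + 1)))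
    (hlo : lo ≤ m) {s : State} (hs : I lo s) :
    Run (.loop (.lt (.var x) (.var y)) c) s (loopTime m T) (I m) := by
  suffices H : ∀ d k s, lo ≤ k → k + d = m → I k s →
      Run (.loop (.lt (.var x) (.var y)) c) s (loopTime d T) (I m) by
    refine (H (m - lo) lo s le_rfl (by omega) hs).mono ?_ fun _ h => h
    have := Nat.mul_le_mul_right (T + 4) (Nat.sub_le m lo)
    simp only [loopTime]
    omega
  intro d
  induction d with
  | zero =>
    intro k s _ hk hI
    refine ⟨_, s, .loopDone ?_, ?_, ?_⟩
    · simp only [Exp.eval, hx k s hI, hy k s hI]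
      rw [if_neg (by omega)]
    · simp [Exp.cost, loopTime]
    · rwa [← hk]
  | succ d ih =>
    intro k s hlk hk hI
    obtain ⟨t₁, s₁, he₁, ht₁, hI₁⟩ := hc k s hlk (by omega) hI
    obtain ⟨t₂, s₂, he₂, ht₂, hI₂⟩ := ih (k + 1) s₁ (by omega) (by omega) hI₁
    refine ⟨_, s₂, .loopStep ?_ he₁ he₂, ?_, hI₂⟩
    · simp only [Exp.eval, hx k s hI, hy k s hI]
      rw [if_pos (by omega)]
      exact one_ne_zero
    · simp only [loopTime, Exp.cost] at ht₂ ⊢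
      rw [Nat.succ_mul]
      omega

/-- Registers below `m` and the adjacency matrix are unchanged. -/
def Keeps (m : ℕ) (s s' : State) : Prop :=
  (∀ x < m, s'.var x = s.var x) ∧ s'.arr 0 = s.arr 0

theorem Keeps.refl (m : ℕ) (s : State) : Keeps m s s :=
  ⟨fun _ _ => rfl, rfl⟩

theorem Keeps.trans {m m' : ℕ} {s s' s'' : State} (h : Keeps m s s') (h' : Keeps m' s' s'')
    (hm : m ≤ m') : Keeps m s s'' :=
  ⟨fun x hx => (h'.1 x (hx.trans_le hm)).trans (h.1 x hx), h'.2.trans h.2⟩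

theorem Keeps.anti {m m' : ℕ} {s s' : State} (h : Keeps m' s s') (hm : m ≤ m') : Keeps m s s' :=
  ⟨fun x hx => h.1 x (hx.trans_le hm), h.2⟩

theorem Keeps.setVar {m : ℕ} {s s' : State} (h : Keeps m s s') {x : ℕ} (hx : m ≤ x) (v : ℕ) :
    Keeps m s (s'.setVar x v) :=
  h.trans ⟨fun y hy => by simp [(hy.trans_le hx).ne], rfl⟩ le_rfl

theorem Keeps.setArr {m : ℕ} {s s' : State} (h : Keeps m s s') {a : ℕ} (ha : a ≠ 0) (i v : ℕ) :
    Keeps m s (s'.setArr a i v) :=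
  h.trans ⟨fun y _ => rfl, by simp [ha.symm]⟩ le_rfl

end Machine

/-! ### Merging twin modules, as a function on arrays -/

section Reduction

/-- `iter f k c = f (k - 1) (⋯ (f 0 c))`. -/
def iter {α : Type*} (f : ℕ → α → α) : ℕ → α → α
  | 0, c => c
  | k + 1, c => f k (iter f k c)

/-- Columns `i` and `j` of the `n × n` matrix `A` agree in all rows `k ≠ i, j` with `w k ≠ 0`. -/
def ColsAgree (A : ℕ → ℕ) (n : ℕ) (w : ℕ → ℕ) (i j : ℕ) : Prop :=
  ∀ k < n, w k ≠ 0 → k ≠ i → k ≠ j → A (k * n + i) = A (k * n + j)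

/-- Module `j` may be merged into module `i`. -/
def Mergeable (A : ℕ → ℕ) (n : ℕ) (w : ℕ → ℕ) (i j : ℕ) : Prop :=
  i < j ∧ w i ≠ 0 ∧ w j ≠ 0 ∧ ColsAgree A n w i j

/-- Values (first component) and weights (second component) after merging `j` into `i`. -/
def merge (A : ℕ → ℕ) (n i j : ℕ) (c : (ℕ → ℕ) × (ℕ → ℕ)) : (ℕ → ℕ) × (ℕ → ℕ) :=
  (Function.update c.1 i (if A (i * n + j) = 0 then c.1 i + c.1 j
      else max (c.1 i - c.2 j) (c.1 j - c.2 i)),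
    Function.update (Function.update c.2 i (c.2 i + c.2 j)) j 0)

open Classical in
/-- Merge `j` into `i` if this is possible. -/
noncomputable def attempt (A : ℕ → ℕ) (n i j : ℕ) (c : (ℕ → ℕ) × (ℕ → ℕ)) :
    (ℕ → ℕ) × (ℕ → ℕ) :=
  if Mergeable A n c.2 i j then merge A n i j c else c

/-- Attempt all merges into `i`. -/
noncomputable def attemptRow (A : ℕ → ℕ) (n i : ℕ) (c : (ℕ → ℕ) × (ℕ → ℕ)) :
    (ℕ → ℕ) × (ℕ → ℕ) :=
  iter (attempt A n i) n c

/-- Attempt all merges. -/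
noncomputable def attemptAll (A : ℕ → ℕ) (n : ℕ) (c : (ℕ → ℕ) × (ℕ → ℕ)) :
    (ℕ → ℕ) × (ℕ → ℕ) :=
  iter (attemptRow A n) n c

/-- Attempt all merges `n` times. -/
noncomputable def reduce (A : ℕ → ℕ) (n : ℕ) (c : (ℕ → ℕ) × (ℕ → ℕ)) :
    (ℕ → ℕ) × (ℕ → ℕ) :=
  iter (fun _ => attemptAll A n) n c

end Reduction

/-! ### The program and its execution -/

section Program

/-- One step of `checkProg`: compares row `k` of the columns `i` and `j`. Register `2` holds `n`,
registers `9`, `10`, `11`, `12` hold `i`, `j`, `k`, `k * n`. -/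
def checkStep : Prog :=
  .seq
    (.ite (.get 2 (.var 11))
      (.ite (.eq (.var 11) (.var 9))
        (.assign 14 (.get 0 (.add (.var 12) (.var 10))))
        (.ite (.eq (.var 11) (.var 10)) .skip
          (.ite (.eq (.get 0 (.add (.var 12) (.var 9))) (.get 0 (.add (.var 12) (.var 10))))
            .skip (.assign 13 (.const 0)))))
      .skip)
    (.seq (.assign 11 (.add (.var 11) (.const 1))) (.assign 12 (.add (.var 12) (.var 2))))

/-- Puts into register `13` whether the columns `i` and `j` agree, and entry `(i, j)` into
register `14`. -/
def checkProg : Prog :=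
  .seq (.seq (.assign 13 (.const 1)) (.seq (.assign 11 (.const 0)) (.assign 12 (.const 0))))
    (.loop (.lt (.var 11) (.var 2)) checkStep)

/-- Merges `j` into `i`. -/
def mergeProg : Prog :=
  .seq
    (.ite (.var 14)
      (.put 1 (.var 9)
        (.add (.sub (.get 1 (.var 9)) (.get 2 (.var 10)))
          (.sub (.sub (.get 1 (.var 10)) (.get 2 (.var 9)))
            (.sub (.get 1 (.var 9)) (.get 2 (.var 10))))))
      (.put 1 (.var 9) (.add (.get 1 (.var 9)) (.get 1 (.var 10)))))
    (.seq (.put 2 (.var 9) (.add (.get 2 (.var 9)) (.get 2 (.var 10))))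
      (.put 2 (.var 10) (.const 0)))

/-- Merges `j` into `i` if this is possible. -/
def attemptProg : Prog :=
  .ite (.lt (.var 9) (.var 10))
    (.ite (.get 2 (.var 9))
      (.ite (.get 2 (.var 10))
        (.seq checkProg (.ite (.var 13) mergeProg .skip))
        .skip)
      .skip)
    .skip

/-- `for x < n do c`, where register `2` holds `n`. -/
def forProg (x : ℕ) (c : Prog) : Prog :=
  .seq (.assign x (.const 0))
    (.loop (.lt (.var x) (.var 2)) (.seq c (.assign x (.add (.var x) (.const 1)))))

/-- Merges modules as long as possible. -/
def reduceProg : Prog :=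
  forProg 8 (forProg 9 (forProg 10 attemptProg))

/-- Initializes all values with register `7` and all weights with register `5`. -/
def initProg : Prog :=
  forProg 11 (.seq (.put 1 (.var 11) (.var 7)) (.put 2 (.var 11) (.var 5)))

/-- Outputs `q` (register `4`) and `p + q` (`p` in register `6`) if the value of the graph lies
strictly between `0` and `n + 1` (register `3`). -/
def testProg : Prog :=
  .seq (.seq initProg reduceProg)
    (.ite (.lt (.const 0) (.get 1 (.const 0)))
      (.ite (.lt (.get 1 (.const 0)) (.var 3))
        (.seq (.assign 0 (.var 4)) (.assign 1 (.add (.var 6) (.var 4)))) .skip)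
      .skip)

/-- Runs `testProg` for `p = q, …, n`; the registers `5` and `7` hold `q * (n + 1)` and
`1 + p * (n + 1)`. -/
def rowProg : Prog :=
  .seq (.seq (.assign 6 (.var 4)) (.assign 7 (.add (.var 5) (.const 1))))
    (.loop (.lt (.var 6) (.var 3))
      (.seq testProg
        (.seq (.assign 6 (.add (.var 6) (.const 1))) (.assign 7 (.add (.var 7) (.var 3))))))

/-- Computes the tensor capacity of a cograph. -/
def capacityProg : Prog :=
  .seq
    (.seq (.assign 2 (.var 0)) (.seq (.assign 3 (.add (.var 0) (.const 1)))
      (.seq (.assign 0 (.const 1)) (.seq (.assign 1 (.const 1))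
        (.seq (.assign 4 (.const 1)) (.assign 5 (.var 3)))))))
    (.loop (.lt (.var 4) (.var 3))
      (.seq rowProg
        (.seq (.assign 4 (.add (.var 4) (.const 1))) (.assign 5 (.add (.var 5) (.var 3))))))

/-- A bound for the number of steps of `attemptProg`. -/
def attemptTime {R : Type*} [CommSemiring R] (n : R) : R :=
  loopTime n 50 + 80

/-- A bound for the number of steps of `forProg`. -/
def forTime {R : Type*} [CommSemiring R] (n T : R) : R :=
  loopTime n (T + 4) + 2

/-- A bound for the number of steps of `testProg`. -/
def testTime {R : Type*} [CommSemiring R] (n : R) : R :=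
  forTime n 6 + forTime n (forTime n (forTime n (attemptTime n))) + 30

/-- A bound for the number of steps of `capacityProg`. -/
def capacityTime {R : Type*} [CommSemiring R] (n : R) : R :=
  loopTime (n + 1) (loopTime (n + 1) (testTime n + 8) + 14) + 16

/-- Register 12 follows k * n by addition. Entry (i, j) is picked up when the scan passes row i, so
no separate product i * n is needed; this relies on the weight of i being nonzero. -/
theorem run_checkStep {s₀ s : State} {n i j k : ℕ} (hn : s₀.var 2 = n) (hi : s₀.var 9 = i)
    (hj : s₀.var 10 = j) (hK : Keeps 11 s₀ s) (ha : s.arr = s₀.arr) (h₁₁ : s.var 11 = k)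
    (h₁₂ : s.var 12 = k * n)
    (h₁₃ : s.var 13 ≠ 0 ↔ ∀ l < k, s₀.arr 2 l ≠ 0 → l ≠ i → l ≠ j →
      s₀.arr 0 (l * n + i) = s₀.arr 0 (l * n + j))
    (h₁₄ : i < k → s₀.arr 2 i ≠ 0 → s.var 14 = s₀.arr 0 (i * n + j)) :
    Run checkStep s 50 fun s => Keeps 11 s₀ s ∧ s.arr = s₀.arr ∧ s.var 11 = k + 1 ∧
      s.var 12 = (k + 1) * n ∧
      (s.var 13 ≠ 0 ↔ ∀ l < k + 1, s₀.arr 2 l ≠ 0 → l ≠ i → l ≠ j →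
        s₀.arr 0 (l * n + i) = s₀.arr 0 (l * n + j)) ∧
      (i < k + 1 → s₀.arr 2 i ≠ 0 → s.var 14 = s₀.arr 0 (i * n + j)) := by
  have h₂ : s.var 2 = n := (hK.1 2 (by norm_num)).trans hn
  have h₉ : s.var 9 = i := (hK.1 9 (by norm_num)).trans hi
  have h₁₀ : s.var 10 = j := (hK.1 10 (by norm_num)).trans hj
  refine Run.of_loopFree (by simp [checkStep, Prog.LoopFree])
    (by simp [checkStep, Prog.bound, Exp.cost]) ?_
  rw [Nat.forall_lt_succ_right, add_one_mul]
  simp only [checkStep, Prog.result, Exp.eval, ha, h₁₁, h₁₂, h₉, h₁₀]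
  split_ifs <;> simp_all [Keeps.setVar]
  case neg => exact ((hK.setVar (by norm_num) _).setVar (by norm_num) _).setVar (by norm_num) _
  on_goal 4 =>
    refine ⟨((hK.setVar (by norm_num) _).setVar (by norm_num) _).setVar (by norm_num) _, ?_⟩
  all_goals
    intro hle hwi
    rcases hle.lt_or_eq with h | rfl
    · exact h₁₄ h hwi
    · contradiction

theorem run_checkProg {s₀ : State} {n i j : ℕ} (hn : s₀.var 2 = n) (hi : s₀.var 9 = i)
    (hj : s₀.var 10 = j) (hin : i < n) (hwi : s₀.arr 2 i ≠ 0) :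
    Run checkProg s₀ (loopTime n 50 + 6) fun s => Keeps 11 s₀ s ∧ s.arr = s₀.arr ∧
      (s.var 13 ≠ 0 ↔ ColsAgree (s₀.arr 0) n (s₀.arr 2) i j) ∧
      s.var 14 = s₀.arr 0 (i * n + j) := by
  let I : ℕ → State → Prop := fun k s => Keeps 11 s₀ s ∧ s.arr = s₀.arr ∧ s.var 11 = k ∧
      s.var 12 = k * n ∧
      (s.var 13 ≠ 0 ↔ ∀ l < k, s₀.arr 2 l ≠ 0 → l ≠ i → l ≠ j →
        s₀.arr 0 (l * n + i) = s₀.arr 0 (l * n + j)) ∧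
      (i < k → s₀.arr 2 i ≠ 0 → s.var 14 = s₀.arr 0 (i * n + j))
  refine (Run.seq (R := I 0) (T₁ := 6) (T₂ := loopTime n 50) ?_ fun s hs =>
    (Run.loop (I := I) (lo := 0) (fun k s h => h.2.2.1)
      (fun k s h => (h.1.1 2 (by norm_num)).trans hn) ?_ (Nat.zero_le _) hs)).mono
      (by omega) ?_
  · refine Run.of_loopFree (by simp [Prog.LoopFree]) (by simp [Prog.bound, Exp.cost]) ?_
    refine ⟨(((Keeps.refl 11 s₀).setVar (by norm_num) _).setVar (by norm_num) _).setVar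
      (by norm_num) _, ?_⟩
    simp [Prog.result, Exp.eval]
  · rintro k s - - ⟨hK, ha, h₁₁, h₁₂, h₁₃, h₁₄⟩
    exact run_checkStep hn hi hj hK ha h₁₁ h₁₂ h₁₃ h₁₄
  · rintro s ⟨hK, ha, -, -, h₁₃, h₁₄⟩
    exact ⟨hK, ha, h₁₃, h₁₄ hin hwi⟩

/-- The values and weights stored in memory. -/
def State.config (s : State) : (ℕ → ℕ) × (ℕ → ℕ) := (s.arr 1, s.arr 2)

theorem run_mergeProg {s₀ s : State} {n i j : ℕ} (hK : Keeps 11 s₀ s) (ha : s.arr = s₀.arr)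
    (hi : s₀.var 9 = i) (hj : s₀.var 10 = j) (h₁₄ : s.var 14 = s₀.arr 0 (i * n + j)) :
    Run mergeProg s 60 fun s => Keeps 11 s₀ s ∧
      s.config = merge (s₀.arr 0) n i j s₀.config := by
  have h₉ : s.var 9 = i := (hK.1 9 (by norm_num)).trans hi
  have h₁₀ : s.var 10 = j := (hK.1 10 (by norm_num)).trans hj
  refine Run.of_loopFree (by simp [mergeProg, Prog.LoopFree])
    (by simp [mergeProg, Prog.bound, Exp.cost]) ?_
  simp only [mergeProg, Prog.result, Exp.eval, h₉, h₁₀, h₁₄, ha]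
  split_ifs with h
  · refine ⟨((hK.setArr (by norm_num) _ _).setArr (by norm_num) _ _).setArr (by norm_num) _ _, ?_⟩
    simp [State.config, merge, h, ha, h₉, h₁₀]
  · refine ⟨((hK.setArr (by norm_num) _ _).setArr (by norm_num) _ _).setArr (by norm_num) _ _, ?_⟩
    -- The machine has no maximum; it is obtained from truncated subtraction.
    have hmax : ∀ a b : ℕ, a + (b - a) = max a b := fun a b => by omega
    simp [State.config, merge, h, ha, h₉, h₁₀, hmax]

theorem run_attemptProg {s₀ : State} {n i j : ℕ} (hn : s₀.var 2 = n) (hi : s₀.var 9 = i)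
    (hj : s₀.var 10 = j) (hjn : j < n) :
    Run attemptProg s₀ (attemptTime n) fun s => Keeps 11 s₀ s ∧
      s.config = attempt (s₀.arr 0) n i j s₀.config := by
  have hskip : ¬Mergeable (s₀.arr 0) n (s₀.arr 2) i j → ∀ T, 1 ≤ T →
      Run .skip s₀ T fun s => Keeps 11 s₀ s ∧
        s.config = attempt (s₀.arr 0) n i j s₀.config := by
    intro h T hT
    refine Run.of_loopFree (by simp [Prog.LoopFree]) hT ⟨Keeps.refl _ _, ?_⟩
    exact (if_neg h).symm
  have hlt : (Exp.lt (.var 9) (.var 10)).eval s₀ = if i < j then 1 else 0 := by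
    simp [Exp.eval, hi, hj]
  have hwi : (Exp.get 2 (.var 9)).eval s₀ = s₀.arr 2 i := by simp [Exp.eval, hi]
  have hwj : (Exp.get 2 (.var 10)).eval s₀ = s₀.arr 2 j := by simp [Exp.eval, hj]
  refine (Run.ite (T := loopTime n 50 + 76) (fun h₁ => ?_) fun h₁ => hskip ?_ _ (by omega)).mono
    (by simp only [Exp.cost, attemptTime]; omega) fun _ h => h
  swap
  · rintro ⟨h, -⟩
    rw [hlt, if_pos h] at h₁
    exact one_ne_zero h₁
  replace h₁ : i < j := by
    by_contra h
    rw [hlt, if_neg h] at h₁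
    exact h₁ rfl
  refine (Run.ite (T := loopTime n 50 + 73) (fun h₂ => ?_) fun h₂ => hskip ?_ _ (by omega)).mono
    (by simp only [Exp.cost]; omega) fun _ h => h
  swap
  · rintro ⟨-, h, -⟩
    exact h (hwi.symm.trans h₂)
  rw [hwi] at h₂
  refine (Run.ite (T := loopTime n 50 + 70) (fun h₃ => ?_) fun h₃ => hskip ?_ _ (by omega)).mono
    (by simp only [Exp.cost]; omega) fun _ h => h
  swap
  · rintro ⟨-, -, h, -⟩
    exact h (hwj.symm.trans h₃)
  rw [hwj] at h₃
  have hite : ∀ s, (Keeps 11 s₀ s ∧ s.arr = s₀.arr ∧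
      (s.var 13 ≠ 0 ↔ ColsAgree (s₀.arr 0) n (s₀.arr 2) i j) ∧
      s.var 14 = s₀.arr 0 (i * n + j)) → Run (.ite (.var 13) mergeProg .skip) s
        ((Exp.var 13).cost + 1 + 60) fun s => Keeps 11 s₀ s ∧
          s.config = attempt (s₀.arr 0) n i j s₀.config := by
    rintro s ⟨hK, ha, h₁₃, h₁₄⟩
    refine Run.ite (fun h => ?_) fun h => ?_
    · refine (run_mergeProg hK ha hi hj h₁₄).mono le_rfl ?_
      · rintro s' ⟨hK', h'⟩
        refine ⟨hK', h'.trans ?_⟩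
        rw [attempt, if_pos]
        exact ⟨h₁, h₂, h₃, h₁₃.1 h⟩
    · refine Run.of_loopFree (by simp [Prog.LoopFree]) (by simp [Prog.bound]) ⟨hK, ?_⟩
      rw [attempt, if_neg]
      · simp [Prog.result, State.config, ha]
      · rintro ⟨-, -, -, h'⟩
        exact h₁₃.2 h' h
  refine (Run.seq (run_checkProg hn hi hj (h₁.trans hjn) h₂) hite).mono ?_ fun _ h => h
  simp only [Exp.cost]
  omega

/-- The body preserves all registers up to x, so the counter survives it, and x > 2 protects the
bound n in register 2. Nested loops therefore use increasing register numbers. -/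
theorem Run.for {x n T : ℕ} {c : Prog} {s₀ : State} (hn : s₀.var 2 = n) (hx : 2 < x)
    {f : ℕ → (ℕ → ℕ) × (ℕ → ℕ) → (ℕ → ℕ) × (ℕ → ℕ)}
    (hc : ∀ k < n, ∀ s, Keeps x s₀ s → s.var x = k →
      Run c s T fun s' => Keeps (x + 1) s s' ∧ s'.config = f k s.config) :
    Run (forProg x c) s₀ (forTime n T) fun s => Keeps x s₀ s ∧
      s.config = iter f n s₀.config := by
  let I : ℕ → State → Prop := fun k s => Keeps x s₀ s ∧ s.var x = k ∧
    s.config = iter f k s₀.config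
  refine (Run.seq (R := I 0) (T₁ := 2) (T₂ := loopTime n (T + 4)) ?_ fun s hs =>
    (Run.loop (I := I) (lo := 0) (fun k s h => h.2.1)
      (fun k s h => (h.1.1 2 hx).trans hn) ?_ (Nat.zero_le _) hs)).mono
      (by simp only [forTime]; omega) fun s h => ⟨h.1, h.2.2⟩
  · refine Run.of_loopFree (by simp [Prog.LoopFree]) (by simp [Prog.bound, Exp.cost]) ?_
    exact ⟨(Keeps.refl x s₀).setVar le_rfl _, by simp [Prog.result, Exp.eval], rfl⟩
  · rintro k s - hk ⟨hK, hsx, hcfg⟩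
    refine Run.seq (hc k hk s hK hsx) ?_
    rintro s' ⟨hK', hcfg'⟩
    refine Run.of_loopFree (by simp [Prog.LoopFree]) (by simp [Prog.bound, Exp.cost]) ?_
    refine ⟨(hK.trans hK' (Nat.le_succ x)).setVar le_rfl _, ?_, ?_⟩
    · simp [Prog.result, Exp.eval, hK'.1 x (Nat.lt_succ_self x), hsx]
    · rw [iter, ← hcfg, ← hcfg']
      rfl

theorem run_reduceProg {s₀ : State} {n : ℕ} (hn : s₀.var 2 = n) :
    Run reduceProg s₀ (forTime n (forTime n (forTime n (attemptTime n)))) fun s =>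
      Keeps 8 s₀ s ∧ s.config = reduce (s₀.arr 0) n s₀.config := by
  refine Run.for hn (by norm_num) fun r _ s₁ hK₁ _ => ?_
  rw [← hK₁.2]
  have hn₁ : s₁.var 2 = n := (hK₁.1 2 (by norm_num)).trans hn
  refine Run.for hn₁ (by norm_num) fun i _ s₂ hK₂ hi => ?_
  rw [← hK₂.2]
  have hn₂ : s₂.var 2 = n := (hK₂.1 2 (by norm_num)).trans hn₁
  refine Run.for hn₂ (by norm_num) fun j hj s₃ hK₃ hj' => ?_
  rw [← hK₃.2]
  exact run_attemptProg ((hK₃.1 2 (by norm_num)).trans hn₂)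
    ((hK₃.1 9 (by norm_num)).trans hi) hj' hj

theorem run_initProg {s₀ : State} {n : ℕ} (hn : s₀.var 2 = n) :
    Run initProg s₀ (forTime n 6) fun s => Keeps 8 s₀ s ∧
      ∀ l < n, s.arr 1 l = s₀.var 7 ∧ s.arr 2 l = s₀.var 5 := by
  refine (Run.for hn (by norm_num) (f := fun k c =>
    (Function.update c.1 k (s₀.var 7), Function.update c.2 k (s₀.var 5))) ?_).mono le_rfl ?_
  · intro k _ s hK hx
    refine Run.of_loopFree (by simp [Prog.LoopFree]) (by simp [Prog.bound, Exp.cost]) ?_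
    refine ⟨((Keeps.refl _ s).setArr (by norm_num) _ _).setArr (by norm_num) _ _, ?_⟩
    simp [Prog.result, Exp.eval, State.config, hx, hK.1 7, hK.1 5]
  · rintro s ⟨hK, hcfg⟩
    refine ⟨hK.anti (by norm_num), ?_⟩
    have key : ∀ (c : (ℕ → ℕ) × (ℕ → ℕ)) (m : ℕ), ∀ l < m,
        (iter (fun k c => (Function.update c.1 k (s₀.var 7),
          Function.update c.2 k (s₀.var 5))) m c).1 l = s₀.var 7 ∧
        (iter (fun k c => (Function.update c.1 k (s₀.var 7),
          Function.update c.2 k (s₀.var 5))) m c).2 l = s₀.var 5 := by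
      intro c m
      induction m with
      | zero => intro l hl; omega
      | succ m ih =>
        intro l hl
        rcases Nat.lt_succ_iff_lt_or_eq.1 hl with h | rfl
        · simpa [iter, h.ne] using ih l h
        · simp [iter]
    have := key s₀.config n
    rw [← hcfg] at this
    exact this

/-- Array cells from n on are not initialised, so the start configuration c is only known below n. A
failed test leaves registers 0 and 1 alone, so an answer found earlier survives. -/
theorem run_testProg {s₀ : State} {n p q : ℕ} (hn : s₀.var 2 = n) (hN : s₀.var 3 = n + 1)
    (hq : s₀.var 4 = q) (hp : s₀.var 6 = p) :
    Run testProg s₀ (testTime n) fun s => (∀ x, 1 < x → x < 8 → s.var x = s₀.var x) ∧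
      s.arr 0 = s₀.arr 0 ∧
      ∃ c : (ℕ → ℕ) × (ℕ → ℕ), (∀ l < n, c.1 l = s₀.var 7 ∧ c.2 l = s₀.var 5) ∧
        ((0 < (reduce (s₀.arr 0) n c).1 0 ∧ (reduce (s₀.arr 0) n c).1 0 < n + 1 ∧
            s.var 0 = q ∧ s.var 1 = p + q) ∨
          ¬(0 < (reduce (s₀.arr 0) n c).1 0 ∧ (reduce (s₀.arr 0) n c).1 0 < n + 1) ∧
            s.var 0 = s₀.var 0 ∧ s.var 1 = s₀.var 1) := by
  refine (Run.seq (Run.seq (run_initProg hn) fun s₁ h₁ =>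
    (run_reduceProg (n := n) ((h₁.1.1 2 (by norm_num)).trans hn)).mono le_rfl
      (Q' := fun s => Keeps 8 s₀ s ∧ ∃ c : (ℕ → ℕ) × (ℕ → ℕ),
        (∀ l < n, c.1 l = s₀.var 7 ∧ c.2 l = s₀.var 5) ∧
          s.config = reduce (s₀.arr 0) n c) fun s₂ h₂ =>
        ⟨h₁.1.trans h₂.1 le_rfl, s₁.config, h₁.2, by rw [h₂.2, h₁.1.2]⟩) (T₂ := 30) ?_).mono
    (by simp only [testTime]; omega) fun _ h => h
  rintro s ⟨hK, c, hc, hcfg⟩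
  refine Run.of_loopFree (by simp [Prog.LoopFree]) (by simp [Prog.bound, Exp.cost]) ?_
  have h₁ : s.arr 1 = (reduce (s₀.arr 0) n c).1 := congrArg Prod.fst hcfg
  have h₃ : s.var 3 = n + 1 := (hK.1 3 (by norm_num)).trans hN
  have h₄ : s.var 4 = q := (hK.1 4 (by norm_num)).trans hq
  have h₆ : s.var 6 = p := (hK.1 6 (by norm_num)).trans hp
  have hk₀ := hK.1 0 (by norm_num)
  have hk₁ := hK.1 1 (by norm_num)
  simp only [Prog.result, Exp.eval, h₁, h₃]
  by_cases hpos : 0 < (reduce (s₀.arr 0) n c).1 0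
  · by_cases hlt : (reduce (s₀.arr 0) n c).1 0 < n + 1
    · rw [if_pos hpos, if_pos hlt, if_neg one_ne_zero, if_neg one_ne_zero]
      refine ⟨fun x hx hx' => ?_, hK.2, c, hc, Or.inl ⟨hpos, hlt, ?_, ?_⟩⟩
      · simp [show x ≠ 0 by omega, show x ≠ 1 by omega, hK.1 x hx']
      · simp [h₄]
      · simp [h₄, h₆]
    · rw [if_pos hpos, if_neg hlt, if_neg one_ne_zero, if_pos rfl]
      exact ⟨fun x hx hx' => hK.1 x hx', hK.2, c, hc, Or.inr ⟨fun h => hlt h.2, hk₀, hk₁⟩⟩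
  · rw [if_neg hpos, if_pos rfl]
    exact ⟨fun x hx hx' => hK.1 x hx', hK.2, c, hc, Or.inr ⟨fun h => hpos h.1, hk₀, hk₁⟩⟩

end Program

/-! ### Modules represented by the arrays -/

section Correctness
open Classical

variable {n : ℕ}

theorem inputState_arr (G : SimpleGraph (Fin n)) (k i : Fin n) :
    (inputState G).arr 0 (k * n + i) = if G.Adj k i then 1 else 0 := by
  have : (∃ i' j' : Fin n, (k : ℕ) * n + i = (i' : ℕ) * n + (j' : ℕ) ∧ G.Adj i' j') ↔
      G.Adj k i := by
    constructor
    · rintro ⟨i', j', h, hadj⟩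
      have hn : 0 < n := i.pos
      have h₁ : (k : ℕ) = i' := by
        have := congrArg (· / n) h
        simpa [add_comm, Nat.add_mul_div_right _ _ hn, Nat.div_eq_of_lt] using this
      have h₂ : (i : ℕ) = j' := by
        rw [h₁] at h
        omega
      rw [Fin.ext h₁, Fin.ext h₂]
      exact hadj
    · intro h
      exact ⟨k, i, rfl, h⟩
  simp only [inputState, this, true_and]

theorem inputState_arr_ne_zero (G : SimpleGraph (Fin n)) (k i : Fin n) :
    (inputState G).arr 0 (k * n + i) ≠ 0 ↔ G.Adj k i := by
  rw [inputState_arr]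
  simp

/-- The configuration `c` stores the values and weights of the modules `m ⁻¹ {i}`, where `m` maps
each vertex to the representative of its module. -/
structure Represents (G : SimpleGraph (Fin n)) (P Q : ℕ) (c : (ℕ → ℕ) × (ℕ → ℕ))
    (m : Fin n → Fin n) : Prop where
  idem : ∀ x, m (m x) = m x
  zero : ∀ z : Fin n, (z : ℕ) = 0 → m z = z
  adj : ∀ x y, m x ≠ m y → (G.Adj x y ↔ G.Adj (m x) (m y))
  dead : ∀ i, m i ≠ i → c.2 i = 0
  weight : ∀ i, m i = i → c.2 i = Q * #{x | m x = i}
  value : ∀ i, m i = i → IsValue G P Q {x | m x = i} (c.1 i)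

theorem Represents.of_forall_eq {G : SimpleGraph (Fin n)} {P Q : ℕ} {c : (ℕ → ℕ) × (ℕ → ℕ)}
    (hc : ∀ l < n, c.1 l = P ∧ c.2 l = Q) : Represents G P Q c id where
  idem _ := rfl
  zero _ _ := rfl
  adj _ _ _ := Iff.rfl
  dead i h := absurd rfl h
  weight i _ := by
    have : ({x | id x = i} : Finset (Fin n)) = {i} := by ext; simp
    rw [this, (hc i i.2).2]
    simp
  value i _ := by
    have : ({x | id x = i} : Finset (Fin n)) = {i} := by ext; simp
    rw [this, (hc i i.2).1]
    exact isValue_singleton G P Q i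

theorem Represents.weight_ne_zero {G : SimpleGraph (Fin n)} {P Q : ℕ}
    {c : (ℕ → ℕ) × (ℕ → ℕ)} {m : Fin n → Fin n} (h : Represents G P Q c m) (hQ : 0 < Q)
    {i : Fin n} (hi : m i = i) : c.2 i ≠ 0 := by
  rw [h.weight i hi]
  exact (Nat.mul_pos hQ (card_pos.2 ⟨i, by simpa using hi⟩)).ne'

/-- Modules i and j are twins among the representatives, so their union is again a module, and
between the two all pairs are adjacent or none are. The rules for unions and joins then give the new
value, the stored weights Q|module| being the penalties. Since i < j, vertex 0 is never absorbed. -/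
theorem Represents.merge {G : SimpleGraph (Fin n)} {P Q : ℕ} {c : (ℕ → ℕ) × (ℕ → ℕ)}
    {m : Fin n → Fin n} (h : Represents G P Q c m) (hQ : 0 < Q) {i j : Fin n}
    (hij : Mergeable ((inputState G).arr 0) n c.2 i j) :
    Represents G P Q (merge ((inputState G).arr 0) n i j c)
      fun x => if m x = j then i else m x := by
  obtain ⟨hlt, hwi, hwj, hcols⟩ := hij
  have hi : m i = i := by
    by_contra hc
    exact hwi (h.dead i hc)
  have hj : m j = j := by
    by_contra hc
    exact hwj (h.dead j hc)
  have hne : i ≠ j := fun he => by rw [he] at hlt; exact lt_irrefl _ hlt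
  have hne' : (i : ℕ) ≠ j := hlt.ne
  -- Nonzero weight marks the representatives, as Q > 0, so the column test inspects every row
  -- belonging to one.
  have hcols' : ∀ k, m k = k → k ≠ i → k ≠ j → (G.Adj k i ↔ G.Adj k j) := by
    intro k hk hki hkj
    rw [← inputState_arr_ne_zero, ← inputState_arr_ne_zero,
      hcols k k.2 (h.weight_ne_zero hQ hk) (fun he => hki (Fin.ext he))
        (fun he => hkj (Fin.ext he))]
  have hfix : ∀ l, (if m l = j then i else m l) = l → l ≠ j ∧ m l = l := by
    intro l hl
    by_cases hlj : m l = j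
    · rw [if_pos hlj] at hl
      rw [← hl, hi] at hlj
      exact absurd hlj hne
    · rw [if_neg hlj] at hl
      exact ⟨fun he => hlj (hl.trans he), hl⟩
  have hclass : ∀ l, l ≠ i → l ≠ j →
      ({x | (if m x = j then i else m x) = l} : Finset (Fin n)) =
        ({x | m x = l} : Finset (Fin n)) := by
    intro l hli hlj
    ext x
    simp only [mem_filter, mem_univ, true_and]
    by_cases hx : m x = j
    · rw [if_pos hx, hx]
      exact iff_of_false hli.symm hlj.symm
    · rw [if_neg hx]
  have hclass_i : ({x | (if m x = j then i else m x) = i} : Finset (Fin n)) =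
      ({x | m x = i} : Finset (Fin n)) ∪ ({x | m x = j} : Finset (Fin n)) := by
    ext x
    simp only [mem_filter, mem_univ, true_and, mem_union]
    by_cases hx : m x = j
    · simp [hx]
    · simp [hx]
  have hdis : Disjoint ({x | m x = i} : Finset (Fin n)) ({x | m x = j} : Finset (Fin n)) := by
    rw [Finset.disjoint_left]
    intro x hx hx'
    simp only [mem_filter, mem_univ, true_and] at hx hx'
    exact hne (hx.symm.trans hx')
  have hadj : ∀ x ∈ ({x | m x = i} : Finset (Fin n)), ∀ y ∈ ({x | m x = j} : Finset (Fin n)),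
      (G.Adj x y ↔ G.Adj i j) := by
    intro x hx y hy
    simp only [mem_filter, mem_univ, true_and] at hx hy
    rw [h.adj x y (by rwa [hx, hy]), hx, hy]
  refine ⟨?_, ?_, ?_, ?_, ?_, ?_⟩
  · intro x
    by_cases hx : m x = j
    · simp [hx, hi]
    · simp [hx, h.idem]
  · intro z hz
    have hzj : z ≠ j := by
      rintro rfl
      omega
    simp [h.zero z hz, hzj]
  · intro x y hxy
    by_cases hx : m x = j <;> by_cases hy : m y = j
    · simp [hx, hy] at hxy
    · simp only [if_pos hx, if_neg hy] at hxy ⊢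
      rw [h.adj x y (by rw [hx]; exact fun he => hy he.symm), hx, G.adj_comm, G.adj_comm i]
      exact (hcols' _ (h.idem y) hxy.symm hy).symm
    · simp only [if_neg hx, if_pos hy] at hxy ⊢
      rw [h.adj x y (by rwa [hy]), hy]
      exact (hcols' _ (h.idem x) hxy hx).symm
    · simp only [if_neg hx, if_neg hy] at hxy ⊢
      exact h.adj x y hxy
  · intro l hl
    by_cases hlj : l = j
    · simp [TensorCap.merge, hlj]
    have hli : l ≠ i := by
      rintro rfl
      simp [hi, hlj] at hl
    have hml : m l ≠ l := by
      intro hml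
      simp [hml, hlj] at hl
    simp [TensorCap.merge, Fin.val_ne_of_ne hlj, Fin.val_ne_of_ne hli, h.dead l hml]
  · intro l hl
    obtain ⟨hlj, hml⟩ := hfix l hl
    by_cases hli : l = i
    · subst hli
      rw [hclass_i, card_union_of_disjoint hdis, mul_add, ← h.weight l hi, ← h.weight j hj]
      simp [TensorCap.merge, hne']
    · rw [hclass l hli hlj, ← h.weight l hml]
      simp [TensorCap.merge, Fin.val_ne_of_ne hlj, Fin.val_ne_of_ne hli]
  · intro l hl
    obtain ⟨hlj, hml⟩ := hfix l hl
    by_cases hli : l = i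
    · subst hli
      rw [hclass_i]
      by_cases hA : G.Adj l j
      · have hA' := (inputState_arr_ne_zero G l j).2 hA
        have := (h.value l hi).union_of_adj (h.value j hj) hdis
          fun x hx y hy => (hadj x hx y hy).2 hA
        rw [← h.weight l hi, ← h.weight j hj] at this
        simpa [TensorCap.merge, hA'] using this
      · have hA' := not_not.1 (mt (inputState_arr_ne_zero G l j).1 hA)
        have := (h.value l hi).union_of_not_adj (h.value j hj) hdis
          fun x hx y hy => mt (hadj x hx y hy).1 hA
        simpa [TensorCap.merge, hA'] using this
    · rw [hclass l hli hlj]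
      simpa [TensorCap.merge, Fin.val_ne_of_ne hli] using h.value l hml

/-! ### Termination of the merging -/

/-- The number of modules. -/
noncomputable def moduleCount (n : ℕ) (c : (ℕ → ℕ) × (ℕ → ℕ)) : ℕ :=
  #{i : Fin n | c.2 i ≠ 0}

/-- `f` fixes `c` or decreases `μ`. -/
def FixesOrDecreases {α : Type*} (μ : α → ℕ) (f : α → α) (c : α) : Prop :=
  f c = c ∨ μ (f c) < μ c

/-- Without a drop of μ no step changes anything, so every `f k` was applied to c itself and fixes
it. -/
theorem iter_eq_and_forall_or_lt {α : Type*} {μ : α → ℕ} {f : ℕ → α → α} {n : ℕ}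
    (hf : ∀ k < n, ∀ c, FixesOrDecreases μ (f k) c) (c : α) :
    (iter f n c = c ∧ ∀ k < n, f k c = c) ∨ μ (iter f n c) < μ c := by
  induction n with
  | zero => exact Or.inl ⟨rfl, fun k hk => absurd hk (Nat.not_lt_zero k)⟩
  | succ n ih =>
    have hn := hf n (Nat.lt_succ_self n) (iter f n c)
    rcases ih fun k hk => hf k (Nat.lt_succ_of_lt hk) with ⟨h, h'⟩ | h
    · rw [h] at hn
      rw [iter, h]
      rcases hn with hn | hn
      · refine Or.inl ⟨hn, fun k hk => ?_⟩
        rcases Nat.lt_succ_iff_lt_or_eq.1 hk with hk | rfl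
        · exact h' k hk
        · exact hn
      · exact Or.inr hn
    · right
      rw [iter]
      rcases hn with hn | hn
      · rwa [hn]
      · exact hn.trans h

theorem iter_induction {α : Type*} {p : α → Prop} {f : ℕ → α → α} {n : ℕ}
    (hf : ∀ k < n, ∀ c, p c → p (f k c)) {c : α} (hc : p c) : p (iter f n c) := by
  induction n with
  | zero => exact hc
  | succ n ih =>
    exact hf n (Nat.lt_succ_self n) _ (ih fun k hk => hf k (Nat.lt_succ_of_lt hk))

theorem moduleCount_merge_lt {A : ℕ → ℕ} {c : (ℕ → ℕ) × (ℕ → ℕ)} {i j : ℕ} (hj : j < n)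
    (h : Mergeable A n c.2 i j) : moduleCount n (merge A n i j c) < moduleCount n c := by
  obtain ⟨hlt, hwi, hwj, -⟩ := h
  refine card_lt_card ⟨?_, fun hsub => ?_⟩
  · intro l hl
    simp only [mem_filter, mem_univ, true_and, merge, Function.update_apply] at hl ⊢
    split_ifs at hl with h₁ h₂
    · exact absurd rfl hl
    · rwa [h₂]
    · exact hl
  · have : (⟨j, hj⟩ : Fin n) ∈ ({k : Fin n | (merge A n i j c).2 k ≠ 0} : Finset (Fin n)) :=
      hsub (mem_filter.2 ⟨mem_univ _, hwj⟩)
    exact (mem_filter.1 this).2 (by simp [merge])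

theorem fixesOrDecreases_attempt (A : ℕ → ℕ) (i : ℕ) {j : ℕ} (hj : j < n)
    (c : (ℕ → ℕ) × (ℕ → ℕ)) : FixesOrDecreases (moduleCount n) (attempt A n i j) c := by
  by_cases h : Mergeable A n c.2 i j
  · right
    rw [attempt, if_pos h]
    exact moduleCount_merge_lt hj h
  · left
    rw [attempt, if_neg h]

theorem fixesOrDecreases_attemptRow (A : ℕ → ℕ) (i : ℕ) (c : (ℕ → ℕ) × (ℕ → ℕ)) :
    FixesOrDecreases (moduleCount n) (attemptRow A n i) c :=
  (iter_eq_and_forall_or_lt (fun _ hj c => fixesOrDecreases_attempt A i hj c) c).imp_left And.left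

/-- A sweep without progress would fix the configuration under every attempt, including the possible
merge of j into i, which lowers the count. -/
theorem moduleCount_attemptAll_lt {A : ℕ → ℕ} {c : (ℕ → ℕ) × (ℕ → ℕ)} {i j : Fin n}
    (h : Mergeable A n c.2 i j) : moduleCount n (attemptAll A n c) < moduleCount n c := by
  rcases iter_eq_and_forall_or_lt
    (fun i _ c => fixesOrDecreases_attemptRow (n := n) A i c) c with ⟨-, h'⟩ | h'
  · rcases iter_eq_and_forall_or_lt
      (fun j hj c => fixesOrDecreases_attempt (n := n) A i hj c) c with ⟨-, h''⟩ | h''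
    · have h₁ := h'' j j.2
      have h₂ := moduleCount_merge_lt j.2 h
      rw [attempt, if_pos h] at h₁
      rw [h₁] at h₂
      exact absurd h₂ (lt_irrefl _)
    · have h₁ := h' i i.2
      rw [attemptRow] at h₁
      rw [h₁] at h''
      exact absurd h'' (lt_irrefl _)
  · exact h'

theorem exists_mergeable {G : SimpleGraph (Fin n)} (hG : P4Free G.Adj)
    {c : (ℕ → ℕ) × (ℕ → ℕ)} (hc : 2 ≤ moduleCount n c) :
    ∃ i j : Fin n, Mergeable ((inputState G).arr 0) n c.2 i j := by
  obtain ⟨x, hx, y, hy, hxy, ht⟩ :=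
    hG.exists_twins (fun _ _ h => h.symm) {i : Fin n | c.2 i ≠ 0} hc
  simp only [mem_filter, mem_univ, true_and] at hx hy
  have key : ∀ k < n, c.2 k ≠ 0 → k ≠ x → k ≠ y →
      (inputState G).arr 0 (k * n + x) = (inputState G).arr 0 (k * n + y) := by
    intro k hk hwk hkx hky
    have := ht ⟨k, hk⟩ (by simpa using hwk) (fun h => hkx (congrArg Fin.val h))
      (fun h => hky (congrArg Fin.val h))
    have h₁ := inputState_arr G ⟨k, hk⟩ x
    have h₂ := inputState_arr G ⟨k, hk⟩ y
    simp only [this] at h₁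
    exact h₁.trans h₂.symm
  rcases lt_or_gt_of_ne hxy with h | h
  · exact ⟨x, y, h, hx, hy, key⟩
  · exact ⟨y, x, h, hy, hx, fun k hk hwk hky hkx => (key k hk hwk hkx hky).symm⟩

theorem isValue_reduce {G : SimpleGraph (Fin n)} (hG : P4Free G.Adj) (hn : 0 < n) {P Q : ℕ}
    (hQ : 0 < Q) {c : (ℕ → ℕ) × (ℕ → ℕ)} (hc : ∀ l < n, c.1 l = P ∧ c.2 l = Q) :
    IsValue G P Q univ ((reduce ((inputState G).arr 0) n c).1 0) := by
  set A := (inputState G).arr 0 with hA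
  let p : (ℕ → ℕ) × (ℕ → ℕ) → Prop := fun c => ∃ m, Represents G P Q c m
  have hatt : ∀ i < n, ∀ j < n, ∀ c, p c → p (attempt A n i j c) := by
    rintro i hi j hj c ⟨m, hm⟩
    rw [attempt]
    split_ifs with h
    · exact ⟨_, hm.merge hQ (i := ⟨i, hi⟩) (j := ⟨j, hj⟩) h⟩
    · exact ⟨m, hm⟩
  have hrow : ∀ i < n, ∀ c, p c → p (attemptRow A n i c) := fun i hi _ hc =>
    iter_induction (hatt i hi) hc
  have hrep : p (reduce A n c) :=
    iter_induction (fun _ _ _ hc => iter_induction hrow hc) ⟨id, Represents.of_forall_eq hc⟩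
  -- While two modules remain, twins among the representatives make the next sweep lower the count;
  -- starting from at most n, n sweeps are enough.
  have hcount : ∀ r, moduleCount n (iter (fun _ => attemptAll A n) r c) ≤ 1 ∨
      moduleCount n (iter (fun _ => attemptAll A n) r c) + r ≤ n := by
    intro r
    induction r with
    | zero =>
      right
      have := card_le_univ ({i : Fin n | c.2 i ≠ 0} : Finset (Fin n))
      rwa [Fintype.card_fin] at this
    | succ r ih =>
      rw [iter]
      set d := iter (fun _ => attemptAll A n) r c
      rcases Nat.lt_or_ge (moduleCount n d) 2 with h | h
      · left
        have h₁ : moduleCount n (attemptAll A n d) ≤ moduleCount n d := by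
          rcases iter_eq_and_forall_or_lt
            (fun i _ c => fixesOrDecreases_attemptRow (n := n) A i c) d with ⟨h', -⟩ | h'
          · rw [attemptAll, h']
          · exact h'.le
        omega
      · obtain ⟨i, j, hij⟩ := exists_mergeable hG h
        have := moduleCount_attemptAll_lt (A := A) hij
        omega
  obtain ⟨m, hm⟩ := hrep
  have hle : moduleCount n (reduce A n c) ≤ 1 := by
    have := hcount n
    rw [reduce]
    omega
  let z : Fin n := ⟨0, hn⟩
  have hz : m z = z := hm.zero z rfl
  -- With a single representative left, it must be vertex 0, so cell 0 holds the value of the whole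
  -- graph.
  have hall : ({x | m x = z} : Finset (Fin n)) = univ := by
    ext x
    simp only [mem_filter, mem_univ, true_and, iff_true]
    have h₁ := hm.weight_ne_zero hQ (hm.idem x)
    have h₂ := hm.weight_ne_zero hQ hz
    exact card_le_one.1 hle _ (by simpa using h₁) _ (by simpa using h₂)
  have := hm.value z hz
  rwa [hall] at this

/-! ### The search over all pairs -/

/-- The output registers hold the tensor capacity, or they hold `1` and no pair `(p, q)` with
`S p q` is the minimum ratio. -/
def Correct (G : SimpleGraph (Fin n)) (S : ℕ → ℕ → Prop) (s : State) : Prop :=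
  (s.var 1 ≠ 0 ∧ IsTensorCapacity G ((s.var 0 : ℝ) / (s.var 1 : ℝ))) ∨
    (s.var 0 = 1 ∧ s.var 1 = 1 ∧ ∀ p q, S p q → ¬IsMinRatio G p q)

/-- The memory between the tests. -/
structure Ready (G : SimpleGraph (Fin n)) (q : ℕ) (S : ℕ → ℕ → Prop) (s : State) : Prop where
  var_two : s.var 2 = n
  var_three : s.var 3 = n + 1
  var_four : s.var 4 = q
  var_five : s.var 5 = q * (n + 1)
  arr_zero : s.arr 0 = (inputState G).arr 0
  correct : Correct G S s

theorem run_testProg_ready {G : SimpleGraph (Fin n)} (hG : P4Free G.Adj) (hn : 0 < n)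
    {p q : ℕ} (hq : 1 ≤ q) (hqp : q ≤ p) {S S' : ℕ → ℕ → Prop}
    (hS : ∀ p' q', S' p' q' → S p' q' ∨ (p' = p ∧ q' = q)) {s : State}
    (hs : Ready G q S s) (h₆ : s.var 6 = p) (h₇ : s.var 7 = 1 + p * (n + 1)) :
    Run testProg s (testTime n) fun s' => Ready G q S' s' ∧ s'.var 6 = p ∧
      s'.var 7 = 1 + p * (n + 1) := by
  have : Nonempty (Fin n) := ⟨⟨0, hn⟩⟩
  refine (run_testProg hs.var_two hs.var_three hs.var_four h₆).mono le_rfl ?_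
  rintro s' ⟨hK, hA, c, hc, h⟩
  rw [h₇, hs.var_five] at hc
  rw [hs.arr_zero] at hA h
  have hiff := (isValue_reduce hG hn (by positivity) hc).isMinRatio_iff (p := p) (q := q)
    (N := n + 1) (by simp)
  rw [← and_assoc, ← hiff] at h
  refine ⟨⟨(hK 2 (by norm_num) (by norm_num)).trans hs.var_two,
    (hK 3 (by norm_num) (by norm_num)).trans hs.var_three,
    (hK 4 (by norm_num) (by norm_num)).trans hs.var_four,
    (hK 5 (by norm_num) (by norm_num)).trans hs.var_five, hA, ?_⟩,
    (hK 6 (by norm_num) (by norm_num)).trans h₆, (hK 7 (by norm_num) (by norm_num)).trans h₇⟩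
  rcases h with ⟨⟨hE, U, hU, hU₀, hUe⟩, h₀, h₁⟩ | ⟨hnot, h₀, h₁⟩
  · left
    rw [h₀, h₁]
    exact ⟨by omega, isTensorCapacity_of_expands hq hqp hE hU hU₀ hUe⟩
  · rcases hs.correct with h | ⟨h, h', hno⟩
    · left
      rwa [h₀, h₁]
    · right
      refine ⟨h₀.trans h, h₁.trans h', fun p' q' h => ?_⟩
      rcases hS p' q' h with h | ⟨rfl, rfl⟩
      · exact hno p' q' h
      · exact hnot

theorem run_rowProg {G : SimpleGraph (Fin n)} (hG : P4Free G.Adj) (hn : 0 < n)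
    {q : ℕ} (hq : 1 ≤ q) (hqn : q ≤ n) {s : State}
    (hs : Ready G q (fun p' q' => 1 ≤ q' ∧ q' < q ∧ q' ≤ p' ∧ p' ≤ n) s) :
    Run rowProg s (loopTime (n + 1) (testTime n + 8) + 6)
      (Ready G q fun p' q' => 1 ≤ q' ∧ q' < q + 1 ∧ q' ≤ p' ∧ p' ≤ n) := by
  -- The pairs tested so far: all smaller denominators, and for the denominator q the numerators
  -- below k.
  let S : ℕ → ℕ → ℕ → Prop := fun k p' q' =>
    1 ≤ q' ∧ q' ≤ p' ∧ p' ≤ n ∧ (q' < q ∨ (q' = q ∧ p' < k))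
  let I : ℕ → State → Prop := fun k s =>
    Ready G q (S k) s ∧ s.var 6 = k ∧ s.var 7 = 1 + k * (n + 1)
  refine (Run.seq (R := I q) (T₁ := 6) (T₂ := loopTime (n + 1) (testTime n + 8)) ?_ fun s hs =>
    (Run.loop (I := I) (lo := q) (fun k s h => h.2.1) (fun k s h => h.1.var_three) ?_
      (by omega) hs)).mono (by omega) ?_
  · refine Run.of_loopFree (by simp [Prog.LoopFree]) (by simp [Prog.bound, Exp.cost]) ?_
    refine ⟨⟨?_, ?_, ?_, ?_, ?_, ?_⟩, ?_, ?_⟩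
    · simpa [Prog.result] using hs.var_two
    · simpa [Prog.result] using hs.var_three
    · simpa [Prog.result] using hs.var_four
    · simpa [Prog.result] using hs.var_five
    · simpa [Prog.result] using hs.arr_zero
    · have : Correct G (S q) s := by
        rcases hs.correct with h | ⟨h, h', hno⟩
        · exact Or.inl h
        · refine Or.inr ⟨h, h', fun p' q' ⟨h₁, h₂, h₃, h₄⟩ => hno p' q' ⟨h₁, by omega, h₂, h₃⟩⟩
      simpa [Correct, Prog.result] using this
    · simp [Prog.result, Exp.eval, hs.var_four]
    · simp [Prog.result, Exp.eval, hs.var_five, add_comm]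
  · rintro k s hqk hk ⟨hR, h₆, h₇⟩
    refine Run.seq (T₁ := testTime n) (T₂ := 8)
      (run_testProg_ready hG hn hq hqk (S' := S (k + 1)) ?_ hR h₆ h₇) ?_
    · rintro p' q' ⟨h₁, h₂, h₃, h₄⟩
      simp only [S]
      omega
    · rintro s' ⟨hR', h₆', h₇'⟩
      refine Run.of_loopFree (by simp [Prog.LoopFree]) (by simp [Prog.bound, Exp.cost]) ?_
      refine ⟨⟨?_, ?_, ?_, ?_, ?_, ?_⟩, ?_, ?_⟩
      · simpa [Prog.result] using hR'.var_two
      · simpa [Prog.result] using hR'.var_three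
      · simpa [Prog.result] using hR'.var_four
      · simpa [Prog.result] using hR'.var_five
      · simpa [Prog.result] using hR'.arr_zero
      · simpa [Correct, Prog.result] using hR'.correct
      · simp [Prog.result, Exp.eval, h₆']
      · simp only [Prog.result, Exp.eval, State.setVar_var, h₇', hR'.var_three]
        norm_num
        ring
  · rintro s ⟨hR, -, -⟩
    refine ⟨hR.var_two, hR.var_three, hR.var_four, hR.var_five, hR.arr_zero, ?_⟩
    rcases hR.correct with h | ⟨h, h', hno⟩
    · exact Or.inl h
    · refine Or.inr ⟨h, h', fun p' q' ⟨h₁, h₂, h₃, h₄⟩ => hno p' q' ⟨h₁, h₃, h₄, ?_⟩⟩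
      omega

theorem run_capacityProg {G : SimpleGraph (Fin n)} (hG : P4Free G.Adj) (hn : 0 < n) :
    Run capacityProg (inputState G) (capacityTime n) fun s =>
      s.var 1 ≠ 0 ∧ IsTensorCapacity G ((s.var 0 : ℝ) / (s.var 1 : ℝ)) := by
  have : Nonempty (Fin n) := ⟨⟨0, hn⟩⟩
  let I : ℕ → State → Prop := fun k =>
    Ready G k fun p' q' => 1 ≤ q' ∧ q' < k ∧ q' ≤ p' ∧ p' ≤ n
  refine (Run.seq (R := I 1) (T₁ := 16)
    (T₂ := loopTime (n + 1) (loopTime (n + 1) (testTime n + 8) + 14)) ?_ fun s hs =>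
    (Run.loop (I := I) (lo := 1) (fun k s h => h.var_four) (fun k s h => h.var_three) ?_
      (by omega) hs)).mono (by simp only [capacityTime]; omega) ?_
  · refine Run.of_loopFree (by simp [Prog.LoopFree]) (by simp [Prog.bound, Exp.cost]) ?_
    have h₀ : (inputState G).var 0 = n := by simp [inputState]
    refine ⟨?_, ?_, ?_, ?_, ?_, Or.inr ⟨?_, ?_, fun p' q' h => ?_⟩⟩
    · simp [Prog.result, Exp.eval, h₀]
    · simp [Prog.result, Exp.eval, h₀]
    · simp [Prog.result, Exp.eval]
    · simp [Prog.result, Exp.eval, h₀]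
    · simp [Prog.result]
    · simp [Prog.result, Exp.eval]
    · simp [Prog.result, Exp.eval]
    · omega
  · rintro k s hk hkn hR
    refine Run.seq (T₁ := loopTime (n + 1) (testTime n + 8) + 6) (T₂ := 8)
      (run_rowProg hG hn hk (by omega) hR) ?_
    intro s' hR'
    refine Run.of_loopFree (by simp [Prog.LoopFree]) (by simp [Prog.bound, Exp.cost]) ?_
    refine ⟨?_, ?_, ?_, ?_, ?_, ?_⟩
    · simpa [Prog.result] using hR'.var_two
    · simpa [Prog.result] using hR'.var_three
    · simp [Prog.result, Exp.eval, hR'.var_four]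
    · simp only [Prog.result, Exp.eval, State.setVar_var, hR'.var_three, hR'.var_five]
      norm_num
      ring
    · simpa [Prog.result] using hR'.arr_zero
    · simpa [Correct, Prog.result] using hR'.correct
  · rintro s hR
    rcases hR.correct with h | ⟨h, h', hno⟩
    · exact h
    · refine ⟨by omega, ?_⟩
      -- The default answer 1/1 is still in place and every pair has been rejected, so no minimum
      -- ratio of at least 1 exists and the capacity is 1.
      rw [h, h', Nat.cast_one, div_one]
      rcases isTensorCapacity_one_or_exists_isMinRatio G with h | ⟨p, q, hq, hqp, hp, hm⟩
      · exact h
      · rw [Fintype.card_fin] at hp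
        exact absurd hm (hno p q ⟨hq, by omega, hqp, hp⟩)

/-- The time bounds are defined over every commutative semiring, so the expression bounding the
steps at n also yields the polynomial at X. -/
theorem eval_capacityTime (n : ℕ) :
    (capacityTime (Polynomial.X : Polynomial ℕ)).eval n = capacityTime n := by
  simp [capacityTime, testTime, forTime, attemptTime, loopTime]

end Correctness

end TensorCap

/-- There is a polynomial-time algorithm that computes the tensor capacity of cographs: on (the
adjacency matrix of) any nonempty cograph `G` on `n` vertices, the program halts within `P(n)`
steps with natural numbers `p` and `q ≠ 0` in registers `0` and `1` such that `Θ^T(G) = p / q`. -/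
theorem mainTheorem6 :
    ∃ (c : TensorCap.Prog) (P : Polynomial ℕ),
      ∀ (n : ℕ), 0 < n → ∀ G : SimpleGraph (Fin n), TensorCap.IsCograph G →
        ∃ (t : ℕ) (s : TensorCap.State),
          TensorCap.Exec c (TensorCap.inputState G) t s ∧ t ≤ P.eval n ∧
          s.var 1 ≠ 0 ∧
          TensorCap.IsTensorCapacity G ((s.var 0 : ℝ) / (s.var 1 : ℝ)) := by
  refine ⟨TensorCap.capacityProg, TensorCap.capacityTime Polynomial.X, fun n hn G hG => ?_⟩
  rw [TensorCap.eval_capacityTime]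
  exact TensorCap.run_capacityProg hG.p4Free hn
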